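/- Let $n\ge 0$, let $\Pi(n)$ be the set of set partitions of $[n]=\{1,\dots,n\}$ and $\mathrm{NC}(n)\subseteq\Pi(n)$ the subset of noncrossing ones. **Fermions.** In the exterior algebra over $\mathbb C$ on generators $\theta_1,\dots,\theta_n,\xi_1,\dots,\xi_n$, let $\theta_j\odot(-)$ denote contraction by $\theta_j$ (if $\theta_j$ is the $s$-th factor of a monomial in distinct generators, it is deleted with sign $(-1)^{s-1}$; a monomial without $\theta_j$ is sent to $0$). For nonempty $B\subseteq[n]$ let $\rho_B(f)=\sum_{i\ne j\in B}\xi_i\,(\theta_j\odot f)$ if $|B|>1$, and $\rho_{\{i\}}(f)=\xi_i\,(\theta_i\odot f)$. These operators commute; for $\pi=\{B_1/\cdots/B_k\}\in\Pi(n)$ put $F_\pi=(\rho_{B_1}\circ\cdots\circ\rho_{B_k})(\theta_1\theta_2\cdots\theta_n)$. **Skein action.** Let $s_i=(i,i+1)$, and let $\pi\in\Pi(n)$ be not noncrossing but with $s_i(\pi)$ noncrossing. Then $i,i+1$ lie in different blocks $B_i\ni i$, $B_{i+1}\ni i+1$ of $\pi$, both of size at least $2$. Let $\pi_1,\dots,\pi_4$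 be obtained from $\pi$ by replacing $B_i,B_{i+1}$ respectively by $(B_i\setminus\{i\})\cup\{i+1\},\ (B_{i+1}\setminus\{i+1\})\cup\{i\}$; by $(B_i\cup B_{i+1})\setminus\{i,i+1\},\ \{i,i+1\}$; by $B_i\setminus\{i\},\ B_{i+1}\cup\{i\}$; by $B_i\cup\{i+1\},\ B_{i+1}\setminus\{i+1\}$. They are noncrossing. Put $\sigma(\pi)=\pi_1+\pi_2-\epsilon\,\pi_3-\epsilon'\,\pi_4\in\mathbb C[\mathrm{NC}(n)]$, where $\epsilon=1$ if $|B_i|>2$ and $\epsilon=0$ otherwise, and $\epsilon'=1$ if $|B_{i+1}|>2$ and $\epsilon'=0$ otherwise. For $\pi\in\mathrm{NC}(n)$ set $s_i\cdot\pi=-s_i(\pi)$ if $s_i(\pi)$ is noncrossing, and $s_i\cdot\pi=\sigma(s_i(\pi))$ (with $\sigma$ computed at the index $i$) otherwise. **Theorem.** (1) There is exactly one linear map $p:\mathbb C[\Pi(n)]\to\mathbb C[\mathrm{NC}(n)]$, the crossing resolution, such that for every $\pi\in\Pi(n)$, writing $p(\pi)=\sum_{\mu\in\mathrm{NC}(n)}c_{\pi,\mu}\,\mu$,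 one has $F_\pi=\sum_{\mu\in\mathrm{NC}(n)}c_{\pi,\mu}F_\mu$. There is exactly one linear action of $\mathfrak S_n$ on $\mathbb C[\mathrm{NC}(n)]$, the skein action, in which each $s_i$ ($1\le i\le n-1$) acts by the rule above. (2) Endow $\mathbb C[\Pi(n)]$ with the sign-twisted permutation action $w\star\pi=\operatorname{sign}(w)\,w(\pi)$ and $\mathbb C[\mathrm{NC}(n)]$ with the skein action. Then $p$ is $\mathfrak S_n$-equivariant: $p(w\star x)=w\cdot p(x)$ for all $w\in\mathfrak S_n$ and $x\in\mathbb C[\Pi(n)]$. (3) All coefficients $c_{\pi,\mu}$ are integers, $p(\mu)=\mu$ for every $\mu\in\mathrm{NC}(n)$, and $p$ is surjective. -/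

import Mathlib

namespace SkeinResolution

open Finset

/-- `Part n` is the set `Π(n)` of all set partitions of the `n`-element set `Fin n`. -/
abbrev Part (n : ℕ) : Type := Finpartition (Finset.univ : Finset (Fin n))

/-- `P` crosses `Q` if there are `a < b < c < d` with `a, c ∈ P` and `b, d ∈ Q`. -/
def Crosses {n : ℕ} (P Q : Finset (Fin n)) : Prop :=
  ∃ a ∈ P, ∃ b ∈ Q, ∃ c ∈ P, ∃ d ∈ Q, a < b ∧ b < c ∧ c < d

/-- A set partition is noncrossing if no two distinct blocks cross. -/
def IsNoncrossing {n : ℕ} (π : Part n) : Prop :=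
  ∀ P ∈ π.parts, ∀ Q ∈ π.parts, P ≠ Q → ¬ Crosses P Q

/-- The set `NC(n)` of noncrossing set partitions. -/
abbrev NC (n : ℕ) : Type := {π : Part n // IsNoncrossing π}

/-- The set partition `w(π)`, whose blocks are the images of the blocks of `π` under `w`. -/
def permPart {n : ℕ} (w : Equiv.Perm (Fin n)) (π : Part n) : Part n :=
  Finpartition.ofExistsUnique (π.parts.image fun B => B.map w.toEmbedding)
    (fun _ _ => subset_univ _)
    (fun a _ => by
      obtain ⟨B, ⟨hB, haB⟩, hu⟩ := π.existsUnique_mem (mem_univ (w.symm a))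
      refine ⟨B.map w.toEmbedding, ⟨mem_image_of_mem _ hB, ?_⟩, ?_⟩
      · exact mem_map.2 ⟨w.symm a, haB, by simp⟩
      · rintro C ⟨hC, haC⟩
        obtain ⟨D, hD, rfl⟩ := mem_image.1 hC
        obtain ⟨x, hx, rfl⟩ := mem_map.1 haC
        rw [hu D ⟨hD, by simpa using hx⟩])
    (fun h => by
      obtain ⟨D, hD, h⟩ := mem_image.1 h
      exact π.ne_empty hD (map_eq_empty.1 h))

theorem permPart_parts {n : ℕ} (w : Equiv.Perm (Fin n)) (π : Part n) :
    (permPart w π).parts = π.parts.image fun B => B.map w.toEmbedding := rfl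

theorem permPart_one {n : ℕ} (π : Part n) : permPart 1 π = π := by
  ext B
  simp only [permPart_parts, mem_image]
  constructor
  · rintro ⟨C, hC, rfl⟩
    have : C.map (Equiv.toEmbedding (1 : Equiv.Perm (Fin n))) = C := by
      ext x
      rw [mem_map_equiv]
      rfl
    rwa [this]
  · intro hB
    refine ⟨B, hB, ?_⟩
    ext x
    rw [mem_map_equiv]
    rfl

theorem permPart_mul {n : ℕ} (v w : Equiv.Perm (Fin n)) (π : Part n) :
    permPart (v * w) π = permPart v (permPart w π) := by
  ext B
  simp only [permPart_parts, image_image]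
  have : (fun B : Finset (Fin n) => B.map (Equiv.toEmbedding (v * w))) =
      (fun B => B.map v.toEmbedding) ∘ fun B => B.map w.toEmbedding := by
    funext C
    ext x
    rw [Function.comp_apply, mem_map_equiv, mem_map_equiv, mem_map_equiv]
    rfl
  rw [this]

/-- The sign-twisted permutation action `w ⋆ π = sign(w) · w(π)` on `ℂ[Π(n)]`. -/
noncomputable def signTwistedAction (n : ℕ) :
    Representation ℂ (Equiv.Perm (Fin n)) (Part n →₀ ℂ) where
  toFun w := ((Equiv.Perm.sign w : ℤ) : ℂ) • Finsupp.lmapDomain ℂ ℂ (permPart w)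
  map_one' := by
    have : permPart (1 : Equiv.Perm (Fin n)) = id := funext permPart_one
    rw [this, Finsupp.lmapDomain_id]
    simp [Module.End.one_eq_id]
  map_mul' v w := by
    have : permPart (v * w) = permPart v ∘ permPart w := funext (permPart_mul v w)
    rw [this, Finsupp.lmapDomain_comp]
    ext
    simp [mul_comm]

/-! ### Fermions -/

/-- The exterior algebra over `ℂ` on the `2n` generators `θ_i` (left summand) and `ξ_i`
(right summand). -/
abbrev Fermion (n : ℕ) : Type := ExteriorAlgebra ℂ (Fin n ⊕ Fin n → ℂ)

noncomputable def theta {n : ℕ} (i : Fin n) : Fermion n :=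
  ExteriorAlgebra.ι ℂ (Pi.single (Sum.inl i) 1)

noncomputable def xi {n : ℕ} (i : Fin n) : Fermion n :=
  ExteriorAlgebra.ι ℂ (Pi.single (Sum.inr i) 1)

/-- The contraction `f ↦ θ_j ⊙ f`: left contraction by the coordinate functional dual to `θ_j`. -/
noncomputable def contractTheta {n : ℕ} (j : Fin n) : Module.End ℂ (Fermion n) :=
  CliffordAlgebra.contractLeft (Q := (0 : QuadraticForm ℂ (Fin n ⊕ Fin n → ℂ)))
    (LinearMap.proj (Sum.inl j))

/-- The operator `f ↦ ξ_i · (θ_j ⊙ f)`. -/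
noncomputable def polarization {n : ℕ} (i j : Fin n) : Module.End ℂ (Fermion n) :=
  LinearMap.mulLeft ℂ (xi i) ∘ₗ contractTheta j

/-- The block operator `ρ_B` of a nonempty set `B`: the sum of `f ↦ ξ_i · (θ_j ⊙ f)` over
`i ≠ j` in `B` if `|B| > 1`, and `f ↦ ξ_i · (θ_i ⊙ f)` if `B = {i}`. -/
noncomputable def blockOp {n : ℕ} (B : Finset (Fin n)) : Module.End ℂ (Fermion n) :=
  if 1 < B.card then ∑ i ∈ B, ∑ j ∈ B.erase i, polarization i j
  else ∑ i ∈ B, polarization i i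

theorem polarization_commute {n : ℕ} (a b c d : Fin n) :
    Commute (polarization a b) (polarization c d) := by
  have hcon : ∀ (j i : Fin n) (f : Fermion n),
      contractTheta j (xi i * f) = - (xi i * contractTheta j f) := by
    intro j i f
    have h := CliffordAlgebra.contractLeft_ι_mul
      (Q := (0 : QuadraticForm ℂ (Fin n ⊕ Fin n → ℂ)))
      (d := LinearMap.proj (Sum.inl j)) (Pi.single (Sum.inr i) (1 : ℂ)) f
    have h0 : (LinearMap.proj (Sum.inl j) : Module.Dual ℂ (Fin n ⊕ Fin n → ℂ))
        (Pi.single (Sum.inr i) (1 : ℂ)) = 0 := by simp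
    rw [h0, zero_smul, zero_sub] at h
    exact h
  have hcc : ∀ f : Fermion n,
      contractTheta b (contractTheta d f) = - contractTheta d (contractTheta b f) :=
    fun f => CliffordAlgebra.contractLeft_comm _ _ f
  have hxx : ∀ f : Fermion n, xi a * (xi c * f) = - (xi c * (xi a * f)) := by
    intro f
    have h : xi a * xi c + xi c * xi a = (0 : Fermion n) :=
      ExteriorAlgebra.ι_add_mul_swap _ _
    rw [← mul_assoc, ← mul_assoc, eq_neg_of_add_eq_zero_left h, neg_mul]
  refine LinearMap.ext fun f => ?_
  change xi a * contractTheta b (xi c * contractTheta d f) =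
    xi c * contractTheta d (xi a * contractTheta b f)
  rw [hcon, hcon, hcc, mul_neg, mul_neg, mul_neg, hxx]
  simp

theorem blockOp_commute {n : ℕ} (A B : Finset (Fin n)) : Commute (blockOp A) (blockOp B) := by
  have key : ∀ T : Module.End ℂ (Fermion n), (∀ i j, Commute T (polarization i j)) →
      ∀ B : Finset (Fin n), Commute T (blockOp B) := by
    intro T hT B
    unfold blockOp
    split_ifs
    · exact Commute.sum_right _ _ _ fun i _ => Commute.sum_right _ _ _ fun j _ => hT i j
    · exact Commute.sum_right _ _ _ fun i _ => hT i i
  exact key _ (fun i j => (key _ (fun k l => polarization_commute i j k l) A).symm) B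

/-- The operator `ρ_π`, the composition of the (commuting) block operators of the blocks
of `π`. -/
noncomputable def partOp {n : ℕ} (π : Part n) : Module.End ℂ (Fermion n) :=
  π.parts.noncommProd blockOp fun A _ B _ _ => blockOp_commute A B

/-- The fermion `F_π = ρ_π (θ_1 θ_2 ⋯ θ_n)`. -/
noncomputable def fermionF {n : ℕ} (π : Part n) : Fermion n :=
  partOp π (List.ofFn fun i : Fin n => theta i).prod

/-- `p : ℂ[Π(n)] → ℂ[NC(n)]` is the crossing resolution: writing `p(π) = ∑_μ c_{π,μ} μ`, one has
`F_π = ∑_μ c_{π,μ} F_μ`, for every set partition `π`. -/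
def IsCrossingResolution {n : ℕ} (p : (Part n →₀ ℂ) →ₗ[ℂ] (NC n →₀ ℂ)) : Prop :=
  ∀ π : Part n,
    fermionF π = (p (Finsupp.single π 1)).sum fun (μ : NC n) (c : ℂ) => c • fermionF μ.1

/-! ### The skein action -/

/-- Replace the blocks `A`, `B` of `π` by `C`, `D`, where `C` and `D` are nonempty, disjoint and
have the same union as `A` and `B`. -/
def replaceBlocks {n : ℕ} (π : Part n) (A B C D : Finset (Fin n))
    (hA : A ∈ π.parts) (hB : B ∈ π.parts) (hC : C.Nonempty) (hD : D.Nonempty)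
    (hCD : Disjoint C D) (hU : C ∪ D = A ∪ B) : Part n :=
  Finpartition.ofExistsUnique ((π.parts \ {A, B}) ∪ {C, D})
    (fun _ _ => subset_univ _)
    (fun a _ => by
      obtain ⟨P, ⟨hP, haP⟩, hu⟩ := π.existsUnique_mem (mem_univ a)
      have hiff : a ∈ C ∨ a ∈ D ↔ a ∈ A ∨ a ∈ B := by
        rw [← mem_union, ← mem_union, hU]
      have hdis : a ∈ C → a ∉ D := fun h h' => disjoint_left.1 hCD h h'
      by_cases h : a ∈ A ∨ a ∈ B
      · have hno : ∀ Q ∈ π.parts, Q ≠ A → Q ≠ B → a ∉ Q := by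
          intro Q hQ h1 h2 haQ
          rcases h with h | h
          · exact h1 (π.eq_of_mem_parts hQ hA haQ h)
          · exact h2 (π.eq_of_mem_parts hQ hB haQ h)
        rcases hiff.2 h with hc | hd
        · refine ⟨C, ⟨by simp, hc⟩, ?_⟩
          rintro Q ⟨hQ, haQ⟩
          simp only [mem_union, mem_sdiff, mem_insert, mem_singleton, not_or] at hQ
          grind
        · refine ⟨D, ⟨by simp, hd⟩, ?_⟩
          rintro Q ⟨hQ, haQ⟩
          simp only [mem_union, mem_sdiff, mem_insert, mem_singleton, not_or] at hQ
          grind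
      · refine ⟨P, ⟨?_, haP⟩, ?_⟩
        · simp only [mem_union, mem_sdiff, mem_insert, mem_singleton, not_or]
          grind
        · rintro Q ⟨hQ, haQ⟩
          simp only [mem_union, mem_sdiff, mem_insert, mem_singleton, not_or] at hQ
          grind)
    (by
      have h1 := hC.ne_empty
      have h2 := hD.ne_empty
      have h3 := π.empty_notMem_parts
      simp only [mem_union, mem_sdiff, mem_insert, mem_singleton, not_or]
      grind)

/-- Replacing `A`, `B` by `C`, `D` gives a noncrossing partition as soon as the new family of blocks
has no crossing. -/
theorem replaceBlocks_noncrossing {n : ℕ} {π : Part n} {A B C D : Finset (Fin n)}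
    {hA : A ∈ π.parts} {hB : B ∈ π.parts} {hC : C.Nonempty} {hD : D.Nonempty}
    {hCD : Disjoint C D} {hU : C ∪ D = A ∪ B}
    (h1 : ∀ P ∈ π.parts, ∀ Q ∈ π.parts, P ≠ A → P ≠ B → Q ≠ A → Q ≠ B → P ≠ Q → ¬ Crosses P Q)
    (h2 : ∀ P ∈ π.parts, P ≠ A → P ≠ B → ¬ Crosses P (A ∪ B) ∧ ¬ Crosses (A ∪ B) P)
    (h3 : ¬ Crosses C D) (h4 : ¬ Crosses D C) :
    IsNoncrossing (replaceBlocks π A B C D hA hB hC hD hCD hU) := by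
  have mono : ∀ {P Q P' Q' : Finset (Fin n)}, P ⊆ P' → Q ⊆ Q' → Crosses P Q → Crosses P' Q' := by
    rintro P Q P' Q' hP hQ ⟨a, ha, b, hb, c, hc, d, hd, h⟩
    exact ⟨a, hP ha, b, hQ hb, c, hP hc, d, hQ hd, h⟩
  have hCs : C ⊆ A ∪ B := hU ▸ subset_union_left
  have hDs : D ⊆ A ∪ B := hU ▸ subset_union_right
  intro P hP Q hQ hne
  change P ∈ (π.parts \ {A, B}) ∪ {C, D} at hP
  change Q ∈ (π.parts \ {A, B}) ∪ {C, D} at hQ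
  simp only [mem_union, mem_sdiff, mem_insert, mem_singleton, not_or] at hP hQ
  rcases hP with ⟨hP, hPA, hPB⟩ | rfl | rfl <;> rcases hQ with ⟨hQ, hQA, hQB⟩ | rfl | rfl
  · exact h1 P hP Q hQ hPA hPB hQA hQB hne
  · exact fun h => (h2 P hP hPA hPB).1 (mono subset_rfl hCs h)
  · exact fun h => (h2 P hP hPA hPB).1 (mono subset_rfl hDs h)
  · exact fun h => (h2 Q hQ hQA hQB).2 (mono hCs subset_rfl h)
  · exact absurd rfl hne
  · exact h3
  · exact fun h => (h2 Q hQ hQA hQB).2 (mono hDs subset_rfl h)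
  · exact h4
  · exact absurd rfl hne

theorem map_swap_of_notMem {n : ℕ} {i j : Fin n} {P : Finset (Fin n)} (hi : i ∉ P) (hj : j ∉ P) :
    P.map (Equiv.swap i j).toEmbedding = P := by
  ext x
  rw [mem_map_equiv, Equiv.symm_swap, Equiv.swap_apply_def]
  split_ifs <;> simp_all

theorem map_swap_of_mem {n : ℕ} {i j : Fin n} {P : Finset (Fin n)} (hi : i ∈ P) (hj : j ∉ P) :
    P.map (Equiv.swap i j).toEmbedding = insert j (P.erase i) := by
  ext x
  rw [mem_map_equiv, Equiv.symm_swap, Equiv.swap_apply_def]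
  have hne : i ≠ j := fun h => hj (h ▸ hi)
  split_ifs <;> simp_all

section ANC

variable {n : ℕ} {π : Part n} {i j : Fin n}

theorem part_mem' (π : Part n) (i : Fin n) : π.part i ∈ π.parts :=
  π.part_mem.2 (mem_univ i)

theorem self_mem (π : Part n) (i : Fin n) : i ∈ π.part i :=
  π.mem_part_self.2 (mem_univ i)

theorem notMem_of_ne {P : Finset (Fin n)} (hP : P ∈ π.parts) (h : P ≠ π.part i) : i ∉ P :=
  fun hi => h (π.part_eq_of_mem hP hi).symm

/-- If `π` crosses but `s_i(π)` does not, then `i` and `i + 1` are in different blocks of `π`. -/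
theorem anc_notMem (hnc : IsNoncrossing (permPart (Equiv.swap i j) π)) (hcr : ¬ IsNoncrossing π) :
    j ∉ π.part i := by
  intro hj
  apply hcr
  have key : ∀ P ∈ π.parts, P ∈ (permPart (Equiv.swap i j) π).parts := by
    intro P hP
    rw [permPart_parts, mem_image]
    refine ⟨P, hP, ?_⟩
    by_cases h : P = π.part i
    · have hi := self_mem π i
      rw [← h] at hi hj
      ext x
      rw [mem_map_equiv, Equiv.symm_swap, Equiv.swap_apply_def]
      split_ifs <;> simp_all
    · have hi := notMem_of_ne hP h
      have hj' : j ∉ P := fun h' => h (π.eq_of_mem_parts hP (part_mem' π i) h' hj)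
      exact map_swap_of_notMem hi hj'
  exact fun P hP Q hQ hne => hnc P (key P hP) Q (key Q hQ) hne

theorem anc_ne (hnc : IsNoncrossing (permPart (Equiv.swap i j) π)) (hcr : ¬ IsNoncrossing π) :
    π.part i ≠ π.part j := fun h => anc_notMem hnc hcr (h ▸ self_mem π j)

theorem anc_notMem' (hnc : IsNoncrossing (permPart (Equiv.swap i j) π))
    (hcr : ¬ IsNoncrossing π) : i ∉ π.part j :=
  notMem_of_ne (part_mem' π j) (anc_ne hnc hcr).symm

theorem anc_disjoint (hnc : IsNoncrossing (permPart (Equiv.swap i j) π))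
    (hcr : ¬ IsNoncrossing π) : ∀ x ∈ π.part i, x ∉ π.part j := fun _ hx hx' =>
  anc_ne hnc hcr (π.eq_of_mem_parts (part_mem' π i) (part_mem' π j) hx hx')

theorem crosses_pair (hij : (i : ℕ) + 1 = j) {P : Finset (Fin n)} :
    ¬ Crosses P {i, j} ∧ ¬ Crosses {i, j} P := by
  constructor
  · rintro ⟨a, _, b, hb, c, _, d, hd, h1, h2, h3⟩
    simp only [mem_insert, mem_singleton] at hb hd
    rcases hb with rfl | rfl <;> rcases hd with rfl | rfl <;> grind
  · rintro ⟨a, ha, b, _, c, hc, d, _, h1, h2, h3⟩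
    simp only [mem_insert, mem_singleton] at ha hc
    rcases ha with rfl | rfl <;> rcases hc with rfl | rfl <;> grind

/-- In a pair of blocks with `i` in one and `i + 1` in the other, not crossing a third set, the
union does not cross that set either. -/
theorem crosses_union (hij : (i : ℕ) + 1 = j) {P X Y : Finset (Fin n)}
    (hiP : i ∉ P) (hjP : j ∉ P) (hjX : j ∈ X) (hiY : i ∈ Y)
    (h1 : ¬ Crosses P X) (h2 : ¬ Crosses X P) (h3 : ¬ Crosses P Y) (h4 : ¬ Crosses Y P) :
    ¬ Crosses P (X ∪ Y) ∧ ¬ Crosses (X ∪ Y) P := by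
  have hp : ∀ x ∈ P, (x < i ∨ j < x) := by
    intro x hx
    have h1 : x ≠ i := fun h => hiP (h ▸ hx)
    have h2 : x ≠ j := fun h => hjP (h ▸ hx)
    grind
  constructor
  · rintro ⟨a, ha, b, hb, c, hc, d, hd, hab, hbc, hcd⟩
    have hpa := hp a ha
    have hpc := hp c hc
    have A1 : ∀ y ∈ X, ∀ z ∈ X, a < y → y < c → c < z → False :=
      fun y hy z hz u v w => h1 ⟨a, ha, y, hy, c, hc, z, hz, u, v, w⟩
    have A2 : ∀ y ∈ X, ∀ z ∈ X, z < a → a < y → y < c → False :=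
      fun y hy z hz u v w => h2 ⟨z, hz, a, ha, y, hy, c, hc, u, v, w⟩
    have A3 : ∀ y ∈ Y, ∀ z ∈ Y, a < y → y < c → c < z → False :=
      fun y hy z hz u v w => h3 ⟨a, ha, y, hy, c, hc, z, hz, u, v, w⟩
    have A4 : ∀ y ∈ Y, ∀ z ∈ Y, z < a → a < y → y < c → False :=
      fun y hy z hz u v w => h4 ⟨z, hz, a, ha, y, hy, c, hc, u, v, w⟩
    rw [mem_union] at hb hd
    rcases hb with hb | hb <;> rcases hd with hd | hd <;> grind
  · rintro ⟨a, ha, b, hb, c, hc, d, hd, hab, hbc, hcd⟩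
    have hpb := hp b hb
    have hpd := hp d hd
    have A1 : ∀ y ∈ X, ∀ z ∈ X, b < y → y < d → d < z → False :=
      fun y hy z hz u v w => h1 ⟨b, hb, y, hy, d, hd, z, hz, u, v, w⟩
    have A2 : ∀ y ∈ X, ∀ z ∈ X, z < b → b < y → y < d → False :=
      fun y hy z hz u v w => h2 ⟨z, hz, b, hb, y, hy, d, hd, u, v, w⟩
    have A3 : ∀ y ∈ Y, ∀ z ∈ Y, b < y → y < d → d < z → False :=
      fun y hy z hz u v w => h3 ⟨b, hb, y, hy, d, hd, z, hz, u, v, w⟩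
    have A4 : ∀ y ∈ Y, ∀ z ∈ Y, z < b → b < y → y < d → False :=
      fun y hy z hz u v w => h4 ⟨z, hz, b, hb, y, hy, d, hd, u, v, w⟩
    rw [mem_union] at ha hc
    rcases ha with ha | ha <;> rcases hc with hc | hc <;> grind

/-- If `X` contains neither `i` nor `i + 1` and does not cross a set `Z` meeting `{i, i + 1}`, then `X`
does not cross any subset `Y` of `Z ∪ {i, i + 1}`. -/
theorem crosses_pair_insert (hij : (i : ℕ) + 1 = j) {X Y Z : Finset (Fin n)}
    (hiX : i ∉ X) (hjX : j ∉ X) (hZ : i ∈ Z ∨ j ∈ Z) (hY : ∀ y ∈ Y, y = i ∨ y = j ∨ y ∈ Z)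
    (h1 : ¬ Crosses X Z) (h2 : ¬ Crosses Z X) :
    ¬ Crosses X Y ∧ ¬ Crosses Y X := by
  have hm : ∀ {S T : Finset (Fin n)}, S ⊆ T →
      (Crosses X S → Crosses X T) ∧ (Crosses S X → Crosses T X) := by
    intro S T hST
    constructor
    · rintro ⟨a, ha, b, hb, c, hc, d, hd, h⟩
      exact ⟨a, ha, b, hST hb, c, hc, d, hST hd, h⟩
    · rintro ⟨a, ha, b, hb, c, hc, d, hd, h⟩
      exact ⟨a, hST ha, b, hb, c, hST hc, d, hd, h⟩
  rcases hZ with hZ | hZ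
  · have h := crosses_union hij hiX hjX (X := {i, j}) (Y := Z) (by simp) hZ
      (crosses_pair hij).1 (crosses_pair hij).2 h1 h2
    have hs : Y ⊆ {i, j} ∪ Z := fun y hy => by
      rcases hY y hy with h | h | h <;> simp [h]
    exact ⟨fun h' => h.1 ((hm hs).1 h'), fun h' => h.2 ((hm hs).2 h')⟩
  · have h := crosses_union hij hiX hjX (X := Z) (Y := {i, j}) hZ (by simp)
      h1 h2 (crosses_pair hij).1 (crosses_pair hij).2
    have hs : Y ⊆ Z ∪ {i, j} := fun y hy => by
      rcases hY y hy with h | h | h <;> simp [h]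
    exact ⟨fun h' => h.1 ((hm hs).1 h'), fun h' => h.2 ((hm hs).2 h')⟩

/-- The noncrossing relations among the blocks of an almost noncrossing partition. -/
theorem anc_relations (hij : (i : ℕ) + 1 = j)
    (hnc : IsNoncrossing (permPart (Equiv.swap i j) π)) (hcr : ¬ IsNoncrossing π) :
    (∀ P ∈ π.parts, ∀ Q ∈ π.parts, P ≠ π.part i → P ≠ π.part j → Q ≠ π.part i → Q ≠ π.part j →
      P ≠ Q → ¬ Crosses P Q) ∧
    (∀ P ∈ π.parts, P ≠ π.part i → P ≠ π.part j →
      ¬ Crosses P (π.part i ∪ π.part j) ∧ ¬ Crosses (π.part i ∪ π.part j) P) ∧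
    ¬ Crosses (insert j ((π.part i).erase i)) (insert i ((π.part j).erase j)) ∧
    ¬ Crosses (insert i ((π.part j).erase j)) (insert j ((π.part i).erase i)) := by
  have hjA := anc_notMem hnc hcr
  have hiB := anc_notMem' hnc hcr
  have hdis := anc_disjoint hnc hcr
  have hij' : i ≠ j := by rintro rfl; omega
  have mA : insert j ((π.part i).erase i) ∈ (permPart (Equiv.swap i j) π).parts := by
    rw [permPart_parts, mem_image]
    exact ⟨_, part_mem' π i, map_swap_of_mem (self_mem π i) hjA⟩
  have mB : insert i ((π.part j).erase j) ∈ (permPart (Equiv.swap i j) π).parts := by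
    rw [permPart_parts, mem_image]
    refine ⟨_, part_mem' π j, ?_⟩
    rw [Equiv.swap_comm]
    exact map_swap_of_mem (self_mem π j) hiB
  have mP : ∀ P ∈ π.parts, P ≠ π.part i → P ≠ π.part j →
      P ∈ (permPart (Equiv.swap i j) π).parts := by
    intro P hP h1 h2
    rw [permPart_parts, mem_image]
    exact ⟨P, hP, map_swap_of_notMem (notMem_of_ne hP h1) (notMem_of_ne hP h2)⟩
  have hAB : insert j ((π.part i).erase i) ≠ insert i ((π.part j).erase j) := by
    intro h
    have : j ∈ insert i ((π.part j).erase j) := h ▸ mem_insert_self _ _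
    simp [hij'.symm] at this
  refine ⟨fun P hP Q hQ h1 h2 h3 h4 hne => hnc P (mP P hP h1 h2) Q (mP Q hQ h3 h4) hne, ?_,
    hnc _ mA _ mB hAB, hnc _ mB _ mA hAB.symm⟩
  intro P hP h1 h2
  have hi := notMem_of_ne hP h1
  have hj := notMem_of_ne hP h2
  have hPA : P ≠ insert j ((π.part i).erase i) := fun h => hj (h ▸ mem_insert_self _ _)
  have hPB : P ≠ insert i ((π.part j).erase j) := fun h => hi (h ▸ mem_insert_self _ _)
  have hU : π.part i ∪ π.part j =
      insert j ((π.part i).erase i) ∪ insert i ((π.part j).erase j) := by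
    have h1 := self_mem π i
    have h2 := self_mem π j
    ext x
    simp only [mem_union, mem_insert, mem_erase]
    grind
  rw [hU]
  exact crosses_union hij hi hj (mem_insert_self _ _) (mem_insert_self _ _)
    (hnc _ (mP P hP h1 h2) _ mA hPA) (hnc _ mA _ (mP P hP h1 h2) hPA.symm)
    (hnc _ (mP P hP h1 h2) _ mB hPB) (hnc _ mB _ (mP P hP h1 h2) hPB.symm)

/-- `π₁`: the blocks `B_i`, `B_{i+1}` are replaced by `(B_i - {i}) ∪ {i+1}` and
`(B_{i+1} - {i+1}) ∪ {i}`. -/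
def skein₁ (π : Part n) (i j : Fin n) (hij : (i : ℕ) + 1 = j)
    (hnc : IsNoncrossing (permPart (Equiv.swap i j) π)) (hcr : ¬ IsNoncrossing π) : NC n :=
  ⟨replaceBlocks π (π.part i) (π.part j)
      (insert j ((π.part i).erase i)) (insert i ((π.part j).erase j))
      (part_mem' π i) (part_mem' π j) (insert_nonempty _ _) (insert_nonempty _ _)
      (by
        have h1 := anc_notMem hnc hcr
        have h2 := anc_notMem' hnc hcr
        have h3 := anc_disjoint hnc hcr
        have h4 : i ≠ j := by rintro rfl; omega
        rw [disjoint_left]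
        intro x
        simp only [mem_insert, mem_erase]
        grind)
      (by
        have h1 := self_mem π i
        have h2 := self_mem π j
        have h3 := anc_notMem hnc hcr
        have h4 := anc_notMem' hnc hcr
        ext x
        simp only [mem_union, mem_insert, mem_erase]
        grind),
    by
      obtain ⟨r1, r2, r3, r4⟩ := anc_relations hij hnc hcr
      exact replaceBlocks_noncrossing r1 r2 r3 r4⟩

/-- `π₂`: the blocks `B_i`, `B_{i+1}` are replaced by `(B_i ∪ B_{i+1}) - {i, i+1}` and
`{i, i+1}`. -/
def skein₂ (π : Part n) (i j : Fin n) (hij : (i : ℕ) + 1 = j)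
    (hnc : IsNoncrossing (permPart (Equiv.swap i j) π)) (hcr : ¬ IsNoncrossing π) : NC n :=
  ⟨replaceBlocks π (π.part i) (π.part j)
      ((π.part i ∪ π.part j) \ {i, j}) {i, j}
      (part_mem' π i) (part_mem' π j)
      (by
        rw [nonempty_iff_ne_empty]
        intro he
        apply hcr
        have hA : π.part i = {i} := by
          have h1 := self_mem π i
          have h2 := anc_notMem hnc hcr
          rw [sdiff_eq_empty_iff_subset] at he
          ext x
          have h3 : x ∈ π.part i → x ∈ ({i, j} : Finset (Fin n)) := fun hx =>
            he (mem_union_left _ hx)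
          simp only [mem_insert, mem_singleton] at h3 ⊢
          grind
        have hB : π.part j = {j} := by
          have h1 := self_mem π j
          have h2 := anc_notMem' hnc hcr
          rw [sdiff_eq_empty_iff_subset] at he
          ext x
          have h3 : x ∈ π.part j → x ∈ ({i, j} : Finset (Fin n)) := fun hx =>
            he (mem_union_right _ hx)
          simp only [mem_insert, mem_singleton] at h3 ⊢
          grind
        have hs : ∀ P ∈ π.parts, P ∈ (permPart (Equiv.swap i j) π).parts := by
          intro P hP
          rw [permPart_parts, mem_image]
          by_cases h1 : P = π.part i
          · exact ⟨π.part j, part_mem' π j, by rw [h1, hA, hB]; simp⟩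
          by_cases h2 : P = π.part j
          · exact ⟨π.part i, part_mem' π i, by rw [h2, hA, hB]; simp⟩
          exact ⟨P, hP, map_swap_of_notMem (notMem_of_ne hP h1) (notMem_of_ne hP h2)⟩
        exact fun P hP Q hQ hne => hnc P (hs P hP) Q (hs Q hQ) hne)
      (insert_nonempty _ _) sdiff_disjoint
      (by
        have h1 := self_mem π i
        have h2 := self_mem π j
        ext x
        simp only [mem_union, mem_insert, mem_singleton, mem_sdiff]
        grind),
    by
      obtain ⟨r1, r2, r3, r4⟩ := anc_relations hij hnc hcr
      exact replaceBlocks_noncrossing r1 r2 (crosses_pair hij).1 (crosses_pair hij).2⟩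

/-- `π₃`: the blocks `B_i`, `B_{i+1}` are replaced by `B_i - {i}` and `B_{i+1} ∪ {i}`. -/
def skein₃ (π : Part n) (i j : Fin n) (hij : (i : ℕ) + 1 = j)
    (hnc : IsNoncrossing (permPart (Equiv.swap i j) π)) (hcr : ¬ IsNoncrossing π)
    (hc : 2 < (π.part i).card) : NC n :=
  ⟨replaceBlocks π (π.part i) (π.part j) ((π.part i).erase i) (insert i (π.part j))
      (part_mem' π i) (part_mem' π j)
      (by
        rw [← card_pos, card_erase_of_mem (self_mem π i)]
        omega)
      (insert_nonempty _ _)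
      (by
        have h3 := anc_disjoint hnc hcr
        rw [disjoint_left]
        intro x
        simp only [mem_insert, mem_erase]
        grind)
      (by
        have h1 := self_mem π i
        ext x
        simp only [mem_union, mem_insert, mem_erase]
        grind),
    by
      obtain ⟨r1, r2, r3, r4⟩ := anc_relations hij hnc hcr
      have h := crosses_pair_insert hij (X := (π.part i).erase i) (Y := insert i (π.part j))
        (Z := insert i ((π.part j).erase j)) (by simp)
        (fun h => anc_notMem hnc hcr (mem_of_mem_erase h)) (by simp)
        (by intro y; simp only [mem_insert, mem_erase]; grind)
        (fun ⟨a, ha, b, hb, c, hc, d, hd, h⟩ =>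
          r3 ⟨a, mem_insert_of_mem ha, b, hb, c, mem_insert_of_mem hc, d, hd, h⟩)
        (fun ⟨a, ha, b, hb, c, hc, d, hd, h⟩ =>
          r4 ⟨a, ha, b, mem_insert_of_mem hb, c, hc, d, mem_insert_of_mem hd, h⟩)
      exact replaceBlocks_noncrossing r1 r2 h.1 h.2⟩

/-- `π₄`: the blocks `B_i`, `B_{i+1}` are replaced by `B_i ∪ {i+1}` and `B_{i+1} - {i+1}`. -/
def skein₄ (π : Part n) (i j : Fin n) (hij : (i : ℕ) + 1 = j)
    (hnc : IsNoncrossing (permPart (Equiv.swap i j) π)) (hcr : ¬ IsNoncrossing π)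
    (hc : 2 < (π.part j).card) : NC n :=
  ⟨replaceBlocks π (π.part i) (π.part j) (insert j (π.part i)) ((π.part j).erase j)
      (part_mem' π i) (part_mem' π j)
      (insert_nonempty _ _)
      (by
        rw [← card_pos, card_erase_of_mem (self_mem π j)]
        omega)
      (by
        have h3 := anc_disjoint hnc hcr
        rw [disjoint_left]
        intro x
        simp only [mem_insert, mem_erase]
        grind)
      (by
        have h1 := self_mem π j
        ext x
        simp only [mem_union, mem_insert, mem_erase]
        grind),
    by
      obtain ⟨r1, r2, r3, r4⟩ := anc_relations hij hnc hcr
      have h := crosses_pair_insert hij (X := (π.part j).erase j) (Y := insert j (π.part i))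
        (Z := insert j ((π.part i).erase i))
        (fun h => anc_notMem' hnc hcr (mem_of_mem_erase h)) (by simp) (by simp)
        (by intro y; simp only [mem_insert, mem_erase]; grind)
        (fun ⟨a, ha, b, hb, c, hc, d, hd, h⟩ =>
          r4 ⟨a, mem_insert_of_mem ha, b, hb, c, mem_insert_of_mem hc, d, hd, h⟩)
        (fun ⟨a, ha, b, hb, c, hc, d, hd, h⟩ =>
          r3 ⟨a, ha, b, mem_insert_of_mem hb, c, hc, d, mem_insert_of_mem hd, h⟩)
      exact replaceBlocks_noncrossing r1 r2 h.2 h.1⟩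

end ANC

/-- The skein relation `σ(π) = π₁ + π₂ - π₃ - π₄` for a crossing partition `π` such that `s_i(π)` is
noncrossing (where `j = i + 1`); the term `π₃` is present only if `|B_i| > 2`, and the term `π₄`
only if `|B_{i+1}| > 2`. -/
noncomputable def skeinSigma {n : ℕ} (π : Part n) (i j : Fin n) (hij : (i : ℕ) + 1 = j)
    (hnc : IsNoncrossing (permPart (Equiv.swap i j) π)) (hcr : ¬ IsNoncrossing π) : NC n →₀ ℂ :=
  Finsupp.single (skein₁ π i j hij hnc hcr) 1 + Finsupp.single (skein₂ π i j hij hnc hcr) 1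
    - (if hc : 2 < (π.part i).card then Finsupp.single (skein₃ π i j hij hnc hcr hc) 1 else 0)
    - (if hc : 2 < (π.part j).card then Finsupp.single (skein₄ π i j hij hnc hcr hc) 1 else 0)

theorem noncrossing_swap_swap {n : ℕ} (τ : NC n) (i j : Fin n) :
    IsNoncrossing (permPart (Equiv.swap i j) (permPart (Equiv.swap i j) τ.1)) := by
  rw [← permPart_mul, Equiv.swap_mul_self, permPart_one]
  exact τ.2

open Classical in
/-- The element `s_i · τ` of `ℂ[NC(n)]`, for a noncrossing partition `τ` and `s_i = (i, j)` with
`j = i + 1`: it is `-s_i(τ)` if `s_i(τ)` is noncrossing, and `σ(s_i(τ))` otherwise. -/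
noncomputable def skeinGenerator {n : ℕ} (i j : Fin n) (hij : (i : ℕ) + 1 = j) (τ : NC n) :
    NC n →₀ ℂ :=
  if h : IsNoncrossing (permPart (Equiv.swap i j) τ.1) then
    - Finsupp.single ⟨permPart (Equiv.swap i j) τ.1, h⟩ 1
  else skeinSigma (permPart (Equiv.swap i j) τ.1) i j hij (noncrossing_swap_swap τ i j) h

/-- `ρ` is the skein action on `ℂ[NC(n)]`: a (linear) action of the symmetric group in which the
adjacent transpositions act by the skein rule. -/
def IsSkeinAction {n : ℕ} (ρ : Representation ℂ (Equiv.Perm (Fin n)) (NC n →₀ ℂ)) : Prop :=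
  ∀ (i j : Fin n) (hij : (i : ℕ) + 1 = j) (τ : NC n),
    ρ (Equiv.swap i j) (Finsupp.single τ 1) = skeinGenerator i j hij τ

end SkeinResolution

namespace SkeinResolution

open Finset

/-! ### Relations between polarization operators -/

/-! Everything is tested on fermions, through the map `ncEval` sending μ to F_μ. It is injective,
and its image contains every F_π with integral coefficients and is stable under the permutation
automorphisms `permFermion`. So the crossing resolution is the unique lift of `partEval` through
`ncEval`, and the skein action is the unique lift of `permFermion`. Equivariance is the identity
w(F_π) = sign(w) F_{w(π)} (`permFermion_fermionF`), whose sign comes from permuting θ_1⋯θ_n.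

The skein rule comes from the five-term relation `blockOp_five_term`. Products of two polarizations
change sign when the contracted indices are exchanged, which gives a three-term relation on four
indices; summed over blocks, it yields F(σ(π)) = -F_π. Hence s_i acts on F_τ by the skein rule
(`ncEval_skeinGenerator`). Since that rule has coefficients ±1, the integral span of the F_μ is
stable under all permutations. Every partition is a relabelling of a noncrossing one, so every F_π
lies in this span.

Injectivity is a triangularity argument. Expanding F_π chooses a pair in each block and gives
monomials with ξ indexed by the first entries and θ by the complement of the second entries. The
choice (minimum, maximum) in every block has the largest spread, so its monomial is isolated by
killing suitable generators (`restrictGens_fermionF`). A noncrossing partition is determined by its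
sets of block minima and maxima (`noncrossing_ext`), so distinct ones have distinct extreme
monomials. -/

theorem contractTheta_xi_mul {n : ℕ} (j i : Fin n) (f : Fermion n) :
    contractTheta j (xi i * f) = - (xi i * contractTheta j f) := by
  have h := CliffordAlgebra.contractLeft_ι_mul
    (Q := (0 : QuadraticForm ℂ (Fin n ⊕ Fin n → ℂ)))
    (d := LinearMap.proj (Sum.inl j)) (Pi.single (Sum.inr i) (1 : ℂ)) f
  have h0 : (LinearMap.proj (Sum.inl j) : Module.Dual ℂ (Fin n ⊕ Fin n → ℂ))
      (Pi.single (Sum.inr i) (1 : ℂ)) = 0 := by simp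
  rw [h0, zero_smul, zero_sub] at h
  exact h

theorem contractTheta_theta_mul {n : ℕ} (j i : Fin n) (f : Fermion n) :
    contractTheta j (theta i * f) = (if i = j then f else 0) - theta i * contractTheta j f := by
  have h := CliffordAlgebra.contractLeft_ι_mul
    (Q := (0 : QuadraticForm ℂ (Fin n ⊕ Fin n → ℂ)))
    (d := LinearMap.proj (Sum.inl j)) (Pi.single (Sum.inl i) (1 : ℂ)) f
  have h0 : (LinearMap.proj (Sum.inl j) : Module.Dual ℂ (Fin n ⊕ Fin n → ℂ))
      (Pi.single (Sum.inl i) (1 : ℂ)) = if i = j then 1 else 0 := by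
    simp [Pi.single_apply, eq_comm]
  rw [h0, ite_smul, one_smul, zero_smul] at h
  exact h

/-- Exchanging the contracted indices of two polarization operators changes the sign. -/
theorem polarization_mul_exchange {n : ℕ} (a b c d : Fin n) :
    polarization a b * polarization c d = - (polarization a d * polarization c b) := by
  refine LinearMap.ext fun f => ?_
  change xi a * contractTheta b (xi c * contractTheta d f) =
    - (xi a * contractTheta d (xi c * contractTheta b f))
  have hcc : contractTheta b (contractTheta d f) = - contractTheta d (contractTheta b f) :=
    CliffordAlgebra.contractLeft_comm _ _ f
  rw [contractTheta_xi_mul, contractTheta_xi_mul, hcc]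
  simp

/-- The sum of the polarizations `i, j` over `i ≠ j` in `S`. -/
noncomputable def pairSum {n : ℕ} (S : Finset (Fin n)) : Module.End ℂ (Fermion n) :=
  ∑ i ∈ S, ∑ j ∈ S.erase i, polarization i j

/-- The sum of the symmetrized polarizations between elements of `S` and of `T`. -/
noncomputable def crossSum {n : ℕ} (S T : Finset (Fin n)) : Module.End ℂ (Fermion n) :=
  ∑ i ∈ S, ∑ j ∈ T, (polarization i j + polarization j i)

theorem blockOp_eq_pairSum {n : ℕ} {S : Finset (Fin n)} (h : 1 < S.card) :
    blockOp S = pairSum S := if_pos h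

theorem pairSum_eq_zero {n : ℕ} {S : Finset (Fin n)} (h : ¬ 1 < S.card) : pairSum S = 0 := by
  refine sum_eq_zero fun i hi => ?_
  have : S.erase i = ∅ := by
    rw [← card_eq_zero, card_erase_of_mem hi]
    omega
  rw [this, sum_empty]

/-- An ordered pair of distinct elements lies inside one of the two sets or straddles them, in one
of two directions. -/
theorem pairSum_union {n : ℕ} {S T : Finset (Fin n)} (h : Disjoint S T) :
    pairSum (S ∪ T) = pairSum S + pairSum T + crossSum S T := by
  have hS : ∀ i ∈ S, ∑ j ∈ (S ∪ T).erase i, polarization i j =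
      (∑ j ∈ S.erase i, polarization i j) + ∑ j ∈ T, polarization i j := by
    intro i hi
    have hiT : i ∉ T := disjoint_left.1 h hi
    rw [erase_union_distrib, erase_eq_of_notMem hiT, sum_union]
    exact h.mono_left (erase_subset _ _)
  have hT : ∀ i ∈ T, ∑ j ∈ (S ∪ T).erase i, polarization i j =
      (∑ j ∈ T.erase i, polarization i j) + ∑ j ∈ S, polarization i j := by
    intro i hi
    have hiS : i ∉ S := disjoint_right.1 h hi
    rw [erase_union_distrib, erase_eq_of_notMem hiS, sum_union, add_comm]
    exact h.mono_right (erase_subset _ _)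
  unfold pairSum crossSum
  rw [sum_union h, sum_congr rfl hS, sum_congr rfl hT]
  simp only [sum_add_distrib]
  rw [sum_comm (s := T) (t := S)]
  abel

theorem pairSum_insert {n : ℕ} {i : Fin n} {S : Finset (Fin n)} (h : i ∉ S) :
    pairSum (insert i S) = pairSum S + crossSum {i} S := by
  rw [insert_eq, pairSum_union (by simpa using h), pairSum_eq_zero (S := {i}) (by simp), zero_add]

theorem crossSum_insert_right {n : ℕ} {j : Fin n} {S T : Finset (Fin n)} (h : j ∉ T) :
    crossSum S (insert j T) = crossSum S {j} + crossSum S T := by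
  simp only [crossSum, sum_insert h, sum_singleton, sum_add_distrib]

theorem commute_pairSum_crossSum {n : ℕ} (S T U : Finset (Fin n)) :
    Commute (pairSum S) (crossSum T U) := by
  unfold pairSum crossSum
  refine Commute.sum_left _ _ _ fun i _ => Commute.sum_left _ _ _ fun j _ =>
    Commute.sum_right _ _ _ fun k _ => Commute.sum_right _ _ _ fun l _ => ?_
  exact (polarization_commute _ _ _ _).add_right (polarization_commute _ _ _ _)

/-- The three pairings of four indices give symmetrized polarizations with zero sum. -/
theorem polarization_three_term {n : ℕ} (i j a b : Fin n) :
    (polarization i a + polarization a i) * (polarization j b + polarization b j) +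
    (polarization j a + polarization a j) * (polarization i b + polarization b i) +
    (polarization a b + polarization b a) * (polarization i j + polarization j i) = 0 := by
  -- Expansion gives twelve products, two for each choice of the two indices multiplied in as ξ. The
  -- two differ by an exchange of contracted indices, hence cancel.
  have e1 := polarization_mul_exchange i a j b
  have e2 := polarization_mul_exchange a b i j
  have e3 := polarization_mul_exchange a i b j
  have e4 := polarization_mul_exchange b a i j
  have e5 := polarization_mul_exchange a b j i
  have e6 := polarization_mul_exchange b a j i
  have c1 := (polarization_commute i b j a).eq
  have c3 := (polarization_commute i a b j).eq
  have c5 := (polarization_commute b i j a).eq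
  simp only [add_mul, mul_add]
  rw [e1, c1, e4, ← c3, e5, e3, e6, c5, e2]
  abel

/-- By bilinearity, this is `polarization_three_term` summed over a ∈ A and b ∈ B. -/
theorem crossSum_three_term {n : ℕ} (i j : Fin n) (A B : Finset (Fin n)) :
    crossSum {i} A * crossSum {j} B + crossSum {j} A * crossSum {i} B +
      crossSum A B * crossSum {i} {j} = 0 := by
  simp only [crossSum, sum_singleton, sum_mul, mul_sum, ← sum_add_distrib]
  rw [sum_comm]
  simp only [← sum_add_distrib]
  exact sum_eq_zero fun a _ => sum_eq_zero fun b _ => polarization_three_term i j a b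

/-- The five-term relation of block operators. -/
theorem blockOp_five_term {n : ℕ} {i j : Fin n} {A B : Finset (Fin n)} (hij : i ≠ j)
    (hiA : i ∉ A) (hiB : i ∉ B) (hjA : j ∉ A) (hjB : j ∉ B) (hAB : Disjoint A B)
    (hA : A.Nonempty) (hB : B.Nonempty) :
    blockOp (insert i A) * blockOp (insert j B) + blockOp (insert j A) * blockOp (insert i B) +
      blockOp (A ∪ B) * blockOp {i, j} =
    (if 1 < A.card then blockOp A * blockOp (insert i (insert j B)) else 0) +
      (if 1 < B.card then blockOp (insert j (insert i A)) * blockOp B else 0) := by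
  have hA' := hA.card_pos
  have hB' := hB.card_pos
  -- On singletons `pairSum` vanishes whereas `blockOp` does not. The size conditions are exactly
  -- what allows `pairSum` to be used throughout.
  have e1 : (if 1 < A.card then blockOp A * blockOp (insert i (insert j B)) else 0) =
      pairSum A * blockOp (insert i (insert j B)) := by
    split_ifs with h
    · rw [blockOp_eq_pairSum h]
    · rw [pairSum_eq_zero h, zero_mul]
  have e2 : (if 1 < B.card then blockOp (insert j (insert i A)) * blockOp B else 0) =
      blockOp (insert j (insert i A)) * pairSum B := by
    split_ifs with h
    · rw [blockOp_eq_pairSum h]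
    · rw [pairSum_eq_zero h, mul_zero]
  have hi2 : i ∉ insert j B := by simp [hij, hiB]
  have hj2 : j ∉ insert i A := by simp [hij.symm, hjA]
  rw [e1, e2, blockOp_eq_pairSum (S := insert i A) (by rw [card_insert_of_notMem hiA]; omega),
    blockOp_eq_pairSum (S := insert j B) (by rw [card_insert_of_notMem hjB]; omega),
    blockOp_eq_pairSum (S := insert j A) (by rw [card_insert_of_notMem hjA]; omega),
    blockOp_eq_pairSum (S := insert i B) (by rw [card_insert_of_notMem hiB]; omega),
    blockOp_eq_pairSum (S := A ∪ B) (by rw [card_union_of_disjoint hAB]; omega),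
    blockOp_eq_pairSum (S := {i, j}) (by rw [card_pair hij]; omega),
    blockOp_eq_pairSum (S := insert i (insert j B))
      (by rw [card_insert_of_notMem hi2, card_insert_of_notMem hjB]; omega),
    blockOp_eq_pairSum (S := insert j (insert i A))
      (by rw [card_insert_of_notMem hj2, card_insert_of_notMem hiA]; omega),
    pairSum_insert hi2, pairSum_insert hj2, pairSum_insert hiA, pairSum_insert hiB,
    pairSum_insert hjA, pairSum_insert hjB, pairSum_union hAB,
    pairSum_insert (S := {j}) (by simpa using hij), pairSum_eq_zero (S := {j}) (by simp),
    crossSum_insert_right hjB, crossSum_insert_right hiA, zero_add]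
  have hsymm : crossSum {j} {i} = crossSum {i} {j} := by
    simp [crossSum, add_comm]
  have h3 := crossSum_three_term i j A B
  -- After expansion this is the only pair of factors met in both orders. All else cancels except
  -- the three-term relation.
  have hc := (commute_pairSum_crossSum B {i} {j}).eq
  rw [hsymm, ← sub_eq_zero]
  simp only [add_mul, mul_add]
  rw [hc, ← h3]
  abel

/-! ### The operator of a set partition -/

/-- The factors commute, so the blocks may be listed in any convenient order. -/
theorem partOp_eq_list_prod {n : ℕ} (π : Part n) (l : List (Finset (Fin n))) (hl : l.Nodup)
    (h : l.toFinset = π.parts) : partOp π = (l.map blockOp).prod := by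
  have h1 := noncommProd_toFinset l (blockOp (n := n)) (fun A _ B _ _ => blockOp_commute A B) hl
  rw [← h1]
  exact noncommProd_congr h.symm (fun _ _ => rfl) _

/-- The product of the block operators over the blocks other than `A` and `B`. -/
noncomputable def restOp {n : ℕ} (π : Part n) (A B : Finset (Fin n)) : Module.End ℂ (Fermion n) :=
  ((π.parts \ {A, B}).toList.map blockOp).prod

theorem partOp_eq_mul_restOp {n : ℕ} (π : Part n) {A B : Finset (Fin n)}
    (hA : A ∈ π.parts) (hB : B ∈ π.parts) (hne : A ≠ B) :
    partOp π = blockOp A * blockOp B * restOp π A B := by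
  rw [partOp_eq_list_prod π (A :: B :: (π.parts \ {A, B}).toList)]
  · simp [restOp, mul_assoc]
  · simp [hne, nodup_toList]
  · ext P
    simp only [List.toFinset_cons, toList_toFinset, mem_insert, mem_sdiff, mem_singleton]
    grind

theorem partOp_replaceBlocks {n : ℕ} (π : Part n) (A B C D : Finset (Fin n))
    (hA : A ∈ π.parts) (hB : B ∈ π.parts) (hC : C.Nonempty) (hD : D.Nonempty)
    (hCD : Disjoint C D) (hU : C ∪ D = A ∪ B) :
    partOp (replaceBlocks π A B C D hA hB hC hD hCD hU) =
      blockOp C * blockOp D * restOp π A B := by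
  -- A new block that is already a block of π must be A or B, so it does not recur among the
  -- untouched blocks.
  have key : ∀ E : Finset (Fin n), E.Nonempty → E ⊆ A ∪ B → E ∈ π.parts → E = A ∨ E = B := by
    rintro E ⟨x, hx⟩ hE hEp
    rcases mem_union.1 (hE hx) with h | h
    · exact Or.inl (π.eq_of_mem_parts hEp hA hx h)
    · exact Or.inr (π.eq_of_mem_parts hEp hB hx h)
  have hC' := key C hC (hU ▸ subset_union_left)
  have hD' := key D hD (hU ▸ subset_union_right)
  have hne : C ≠ D := by
    rintro rfl
    exact hC.ne_empty (disjoint_self.1 hCD)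
  rw [partOp_eq_list_prod _ (C :: D :: (π.parts \ {A, B}).toList)]
  · simp [restOp, mul_assoc]
  · simp only [List.nodup_cons, List.mem_cons, mem_toList, mem_sdiff, mem_insert, mem_singleton,
      nodup_toList, and_true]
    tauto
  · change _ = (π.parts \ {A, B}) ∪ {C, D}
    ext P
    simp only [List.toFinset_cons, toList_toFinset, mem_insert, mem_sdiff, mem_singleton, mem_union]
    tauto

/-- The blocks of `i` and `i + 1` in an almost noncrossing partition cross each other. -/
theorem anc_crosses {n : ℕ} {π : Part n} {i j : Fin n} (hij : (i : ℕ) + 1 = j)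
    (hnc : IsNoncrossing (permPart (Equiv.swap i j) π)) (hcr : ¬ IsNoncrossing π) :
    Crosses (π.part i) (π.part j) ∨ Crosses (π.part j) (π.part i) := by
  obtain ⟨r1, r2, -, -⟩ := anc_relations hij hnc hcr
  have mono : ∀ {P Q P' Q' : Finset (Fin n)}, P ⊆ P' → Q ⊆ Q' → Crosses P Q → Crosses P' Q' := by
    rintro P Q P' Q' hP hQ ⟨a, ha, b, hb, c, hc, d, hd, h⟩
    exact ⟨a, hP ha, b, hQ hb, c, hP hc, d, hQ hd, h⟩
  by_contra! hno
  refine hcr fun P hP Q hQ hne hPQ => ?_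
  have hiU : π.part i ⊆ π.part i ∪ π.part j := subset_union_left
  have hjU : π.part j ⊆ π.part i ∪ π.part j := subset_union_right
  by_cases hPi : P = π.part i
  · by_cases hQj : Q = π.part j
    · exact hno.1 (hPi ▸ hQj ▸ hPQ)
    · exact (r2 Q hQ (fun h => hne (hPi.trans h.symm)) hQj).2 (mono (hPi ▸ hiU) subset_rfl hPQ)
  by_cases hPj : P = π.part j
  · by_cases hQi : Q = π.part i
    · exact hno.2 (hPj ▸ hQi ▸ hPQ)
    · exact (r2 Q hQ hQi (fun h => hne (hPj.trans h.symm))).2 (mono (hPj ▸ hjU) subset_rfl hPQ)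
  by_cases hQi : Q = π.part i
  · exact (r2 P hP hPi hPj).1 (mono subset_rfl (hQi ▸ hiU) hPQ)
  by_cases hQj : Q = π.part j
  · exact (r2 P hP hPi hPj).1 (mono subset_rfl (hQj ▸ hjU) hPQ)
  exact r1 P hP Q hQ hPi hPj hQi hQj hne hPQ

theorem Crosses.one_lt_card {n : ℕ} {P Q : Finset (Fin n)} (h : Crosses P Q) :
    1 < P.card ∧ 1 < Q.card := by
  obtain ⟨a, ha, b, hb, c, hc, d, hd, h1, h2, h3⟩ := h
  exact ⟨Finset.one_lt_card.2 ⟨a, ha, c, hc, (h1.trans h2).ne⟩,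
    Finset.one_lt_card.2 ⟨b, hb, d, hd, (h2.trans h3).ne⟩⟩

/-! ### Evaluation on fermions and the skein relation -/

/-- The linear map `ℂ[NC(n)] → Fermion n`, `μ ↦ F_μ`. -/
noncomputable def ncEval (n : ℕ) : (NC n →₀ ℂ) →ₗ[ℂ] Fermion n :=
  Finsupp.linearCombination ℂ fun μ : NC n => fermionF μ.1

theorem ncEval_single {n : ℕ} (μ : NC n) : ncEval n (Finsupp.single μ 1) = fermionF μ.1 := by
  simp [ncEval]

/-- The fermionic skein relation: `F_π = - F_{σ(π)}`. -/
theorem ncEval_skeinSigma {n : ℕ} (π : Part n) (i j : Fin n) (hij : (i : ℕ) + 1 = j)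
    (hnc : IsNoncrossing (permPart (Equiv.swap i j) π)) (hcr : ¬ IsNoncrossing π) :
    ncEval n (skeinSigma π i j hij hnc hcr) = - fermionF π := by
  have hcard : 1 < (π.part i).card ∧ 1 < (π.part j).card := by
    rcases anc_crosses hij hnc hcr with h | h
    · exact h.one_lt_card
    · exact h.one_lt_card.symm
  have hne : i ≠ j := by rintro rfl; omega
  have hi := self_mem π i
  have hj := self_mem π j
  have hji := anc_notMem hnc hcr
  have hij' := anc_notMem' hnc hcr
  have hdis := anc_disjoint hnc hcr
  have hcA := card_erase_of_mem hi
  have hcB := card_erase_of_mem hj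
  -- With i and j removed from their blocks, the left side of the relation gives π, π₁, π₂ in order,
  -- and the right side gives π₃, π₄.
  have key := blockOp_five_term (A := (π.part i).erase i) (B := (π.part j).erase j) hne
    (by simp) (by simp [hij']) (by simp [hji]) (by simp)
    (disjoint_left.2 fun x hx hx' => hdis x (mem_of_mem_erase hx) (mem_of_mem_erase hx'))
    (card_pos.1 (by omega)) (card_pos.1 (by omega))
  have hU : (π.part i).erase i ∪ (π.part j).erase j = (π.part i ∪ π.part j) \ {i, j} := by
    ext x
    simp only [mem_union, mem_erase, mem_sdiff, mem_insert, mem_singleton]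
    grind
  rw [insert_erase hi, insert_erase hj, hU, hcA, hcB] at key
  have hA2 : (1 < (π.part i).card - 1) ↔ 2 < (π.part i).card := by omega
  have hB2 : (1 < (π.part j).card - 1) ↔ 2 < (π.part j).card := by omega
  simp only [hA2, hB2] at key
  have k2 := congrArg (fun T : Module.End ℂ (Fermion n) => T * restOp π (π.part i) (π.part j)) key
  simp only [add_mul, ite_mul, zero_mul] at k2
  have k3 := LinearMap.congr_fun k2 (List.ofFn fun i : Fin n => theta i).prod
  have hite : ∀ (c : Prop) [Decidable c] (T : Module.End ℂ (Fermion n)) (f : Fermion n),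
      (if c then T else 0) f = if c then T f else 0 := by
    intro c _ T f
    split_ifs <;> rfl
  simp only [LinearMap.add_apply, hite] at k3
  have e1 : fermionF (skein₁ π i j hij hnc hcr).1 =
      (blockOp (insert j ((π.part i).erase i)) * blockOp (insert i ((π.part j).erase j)) * restOp π (π.part i) (π.part j))
        (List.ofFn fun i : Fin n => theta i).prod := by
    unfold skein₁ fermionF
    rw [partOp_replaceBlocks]
  have e2 : fermionF (skein₂ π i j hij hnc hcr).1 =
      (blockOp ((π.part i ∪ π.part j) \ {i, j}) * blockOp {i, j} * restOp π (π.part i) (π.part j))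
        (List.ofFn fun i : Fin n => theta i).prod := by
    unfold skein₂ fermionF
    rw [partOp_replaceBlocks]
  have e3 : ∀ hc, fermionF (skein₃ π i j hij hnc hcr hc).1 =
      (blockOp ((π.part i).erase i) * blockOp (insert i (π.part j)) * restOp π (π.part i) (π.part j))
        (List.ofFn fun i : Fin n => theta i).prod := by
    intro hc
    unfold skein₃ fermionF
    rw [partOp_replaceBlocks]
  have e4 : ∀ hc, fermionF (skein₄ π i j hij hnc hcr hc).1 =
      (blockOp (insert j (π.part i)) * blockOp ((π.part j).erase j) * restOp π (π.part i) (π.part j))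
        (List.ofFn fun i : Fin n => theta i).prod := by
    intro hc
    unfold skein₄ fermionF
    rw [partOp_replaceBlocks]
  have e0 : fermionF π = (blockOp (π.part i) * blockOp (π.part j) *
      restOp π (π.part i) (π.part j)) (List.ofFn fun i : Fin n => theta i).prod :=
    LinearMap.congr_fun
      (partOp_eq_mul_restOp π (part_mem' π i) (part_mem' π j) (anc_ne hnc hcr)) _
  unfold skeinSigma
  rw [map_sub, map_sub, map_add, ncEval_single, ncEval_single, apply_dite (ncEval n),
    apply_dite (ncEval n)]
  simp only [ncEval_single, map_zero, e1, e2, e3, e4, e0]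
  rw [← sub_eq_zero] at k3 ⊢
  refine Eq.trans ?_ k3
  split_ifs <;> abel

/-! ### The action of the symmetric group on fermions -/

/-- The automorphism of the exterior algebra sending `θ_i` to `θ_{w(i)}` and `ξ_i` to `ξ_{w(i)}`. -/
noncomputable def permFermion {n : ℕ} (w : Equiv.Perm (Fin n)) : Fermion n →ₐ[ℂ] Fermion n :=
  ExteriorAlgebra.map (LinearMap.funLeft ℂ ℂ (Equiv.sumCongr w w).symm)

theorem funLeft_symm_single {σ : Type*} [DecidableEq σ] (e : Equiv.Perm σ) (s : σ) :
    LinearMap.funLeft ℂ ℂ e.symm (Pi.single s (1 : ℂ)) = Pi.single (e s) 1 := by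
  ext t
  simp [LinearMap.funLeft_apply, Pi.single_apply, Equiv.symm_apply_eq]

theorem permFermion_theta {n : ℕ} (w : Equiv.Perm (Fin n)) (i : Fin n) :
    permFermion w (theta i) = theta (w i) := by
  unfold permFermion theta
  rw [ExteriorAlgebra.map_apply_ι, funLeft_symm_single]
  rfl

theorem permFermion_xi {n : ℕ} (w : Equiv.Perm (Fin n)) (i : Fin n) :
    permFermion w (xi i) = xi (w i) := by
  unfold permFermion xi
  rw [ExteriorAlgebra.map_apply_ι, funLeft_symm_single]
  rfl

/-- Naturality of contraction: both sides obey the same Leibniz rule on left multiplication by a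
vector, so induction on products suffices. -/
theorem map_contractLeft {M N : Type*} [AddCommGroup M] [Module ℂ M] [AddCommGroup N] [Module ℂ N]
    (φ : M →ₗ[ℂ] N) (d : Module.Dual ℂ N) (f : ExteriorAlgebra ℂ M) :
    ExteriorAlgebra.map φ
      (CliffordAlgebra.contractLeft (Q := (0 : QuadraticForm ℂ M)) (d ∘ₗ φ) f) =
    CliffordAlgebra.contractLeft (Q := (0 : QuadraticForm ℂ N)) d (ExteriorAlgebra.map φ f) := by
  induction f using CliffordAlgebra.left_induction with
  | algebraMap r =>
    rw [CliffordAlgebra.contractLeft_algebraMap, map_zero]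
    have : ExteriorAlgebra.map φ (algebraMap ℂ (CliffordAlgebra (0 : QuadraticForm ℂ M)) r) =
      algebraMap ℂ (CliffordAlgebra (0 : QuadraticForm ℂ N)) r := AlgHom.commutes _ r
    rw [this, CliffordAlgebra.contractLeft_algebraMap]
  | add x y hx hy => simp only [map_add, hx, hy]
  | ι_mul x m hx =>
    have h : ExteriorAlgebra.map φ (CliffordAlgebra.ι (0 : QuadraticForm ℂ M) m) =
        CliffordAlgebra.ι (0 : QuadraticForm ℂ N) (φ m) := ExteriorAlgebra.map_apply_ι φ m
    rw [CliffordAlgebra.contractLeft_ι_mul, map_sub, map_smul, map_mul, map_mul, h, hx,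
      CliffordAlgebra.contractLeft_ι_mul]
    rfl

theorem permFermion_contractTheta {n : ℕ} (w : Equiv.Perm (Fin n)) (j : Fin n) (f : Fermion n) :
    permFermion w (contractTheta j f) = contractTheta (w j) (permFermion w f) := by
  unfold permFermion contractTheta
  -- The functional dual to θ_{w(j)} pulls back to the one dual to θ_j.
  rw [← map_contractLeft]
  congr 3
  ext v
  simp [LinearMap.funLeft_apply]

theorem permFermion_polarization {n : ℕ} (w : Equiv.Perm (Fin n)) (i j : Fin n) (f : Fermion n) :
    permFermion w (polarization i j f) = polarization (w i) (w j) (permFermion w f) := by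
  change permFermion w (xi i * contractTheta j f) = xi (w i) * contractTheta (w j) (permFermion w f)
  rw [map_mul, permFermion_xi, permFermion_contractTheta]

theorem permFermion_blockOp {n : ℕ} (w : Equiv.Perm (Fin n)) (B : Finset (Fin n)) (f : Fermion n) :
    permFermion w (blockOp B f) = blockOp (B.map w.toEmbedding) (permFermion w f) := by
  have he : ∀ i, (B.map w.toEmbedding).erase (w i) = (B.erase i).map w.toEmbedding := fun i => by
    rw [map_erase]
    rfl
  unfold blockOp
  rw [card_map]
  split_ifs
  all_goals simp only [LinearMap.sum_apply, _root_.map_sum, permFermion_polarization, sum_map,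
    Equiv.coe_toEmbedding, he]

theorem permFermion_blockOp_list {n : ℕ} (w : Equiv.Perm (Fin n)) (l : List (Finset (Fin n)))
    (f : Fermion n) : permFermion w ((l.map blockOp).prod f) =
      ((l.map fun B => B.map w.toEmbedding).map blockOp).prod (permFermion w f) := by
  induction l with
  | nil => rfl
  | cons B l ih =>
    simp only [List.map_cons, List.prod_cons, Module.End.mul_apply]
    rw [permFermion_blockOp, ih]

/-- The product of vectors is an alternating map. This is the source of the sign twist on ℂ[Π(n)].
-/
theorem permFermion_thetaProd {n : ℕ} (w : Equiv.Perm (Fin n)) :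
    permFermion w (List.ofFn fun i : Fin n => theta i).prod =
      ((Equiv.Perm.sign w : ℤ) : ℂ) • (List.ofFn fun i : Fin n => theta i).prod := by
  rw [map_list_prod, List.map_ofFn]
  have h := (ExteriorAlgebra.ιMulti ℂ n).map_perm
    (fun i : Fin n => (Pi.single (Sum.inl i) 1 : Fin n ⊕ Fin n → ℂ)) w
  rw [ExteriorAlgebra.ιMulti_apply, ExteriorAlgebra.ιMulti_apply] at h
  have h2 : (permFermion w ∘ fun i : Fin n => theta i) = fun i => theta (w i) :=
    funext (permFermion_theta w)
  rw [h2]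
  refine Eq.trans h ?_
  rw [Units.smul_def, Int.cast_smul_eq_zsmul]
  rfl

/-- The automorphism carries ρ_B to ρ_{w(B)}, and the top θ-monomial contributes the sign. -/
theorem permFermion_fermionF {n : ℕ} (w : Equiv.Perm (Fin n)) (π : Part n) :
    permFermion w (fermionF π) = ((Equiv.Perm.sign w : ℤ) : ℂ) • fermionF (permPart w π) := by
  unfold fermionF
  rw [partOp_eq_list_prod π π.parts.toList (nodup_toList _) (toList_toFinset _),
    partOp_eq_list_prod (permPart w π) (π.parts.toList.map fun B => B.map w.toEmbedding)
      ((nodup_toList _).map (map_injective _)),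
    permFermion_blockOp_list, permFermion_thetaProd, map_smul]
  ext B
  simp [permPart_parts]

/-- The linear map `ℂ[Π(n)] → Fermion n`, `π ↦ F_π`. -/
noncomputable def partEval (n : ℕ) : (Part n →₀ ℂ) →ₗ[ℂ] Fermion n :=
  Finsupp.linearCombination ℂ fermionF

theorem partEval_single {n : ℕ} (π : Part n) : partEval n (Finsupp.single π 1) = fermionF π := by
  simp [partEval]

theorem permFermion_partEval {n : ℕ} (w : Equiv.Perm (Fin n)) (x : Part n →₀ ℂ) :
    permFermion w (partEval n x) = partEval n (signTwistedAction n w x) := by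
  have : (permFermion w).toLinearMap ∘ₗ partEval n = partEval n ∘ₗ signTwistedAction n w := by
    ext π
    simp [partEval, permFermion_fermionF, signTwistedAction]
  exact LinearMap.congr_fun this x

/-- On noncrossing partitions the skein rule is the action of adjacent transpositions on
fermions. -/
theorem ncEval_skeinGenerator {n : ℕ} (i j : Fin n) (hij : (i : ℕ) + 1 = j) (τ : NC n) :
    ncEval n (skeinGenerator i j hij τ) = permFermion (Equiv.swap i j) (fermionF τ.1) := by
  have hne : i ≠ j := by rintro rfl; omega
  rw [permFermion_fermionF, Equiv.Perm.sign_swap hne]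
  unfold skeinGenerator
  -- In both cases the value is -F of the swapped partition: by definition in the first, by the
  -- skein relation in the second.
  split_ifs with h
  · rw [map_neg, ncEval_single]
    simp
  · rw [ncEval_skeinSigma]
    simp

/-! ### Integral spanning by noncrossing partitions -/

/-- Adjacent transpositions generate the symmetric group even as a monoid, so closure under inverses
need not be checked. -/
theorem submonoid_eq_top_of_adjacent {n : ℕ} (S : Submonoid (Equiv.Perm (Fin n)))
    (h : ∀ i j : Fin n, (i : ℕ) + 1 = j → Equiv.swap i j ∈ S) : S = ⊤ := by
  cases n with
  | zero => exact Subsingleton.elim _ _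
  | succ n =>
    rw [eq_top_iff, ← Equiv.Perm.mclosure_swap_castSucc_succ, Submonoid.closure_le]
    rintro _ ⟨i, rfl⟩
    exact h _ _ (by simp)

/-- The `ℤ`-span of the fermions of the noncrossing partitions. -/
noncomputable def ncLattice (n : ℕ) : Submodule ℤ (Fermion n) :=
  Submodule.span ℤ (Set.range fun μ : NC n => fermionF μ.1)

theorem fermionF_mem_ncLattice {n : ℕ} (μ : NC n) : fermionF μ.1 ∈ ncLattice n :=
  Submodule.subset_span ⟨μ, rfl⟩

/-- All coefficients in the skein rule are ±1; this is where integrality originates. -/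
theorem ncEval_skeinGenerator_mem {n : ℕ} (i j : Fin n) (hij : (i : ℕ) + 1 = j) (τ : NC n) :
    ncEval n (skeinGenerator i j hij τ) ∈ ncLattice n := by
  unfold skeinGenerator
  split_ifs with h
  · rw [map_neg, ncEval_single]
    exact neg_mem (fermionF_mem_ncLattice _)
  · unfold skeinSigma
    rw [map_sub, map_sub, map_add, ncEval_single, ncEval_single]
    refine sub_mem (sub_mem (add_mem (fermionF_mem_ncLattice _) (fermionF_mem_ncLattice _)) ?_) ?_
    all_goals
      split_ifs
      · rw [ncEval_single]
        exact fermionF_mem_ncLattice _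
      · rw [map_zero]
        exact zero_mem _

theorem permFermion_swap_mem_ncLattice {n : ℕ} (i j : Fin n) (hij : (i : ℕ) + 1 = j)
    {x : Fermion n} (hx : x ∈ ncLattice n) : permFermion (Equiv.swap i j) x ∈ ncLattice n := by
  induction hx using Submodule.span_induction with
  | mem x hx =>
    obtain ⟨τ, rfl⟩ := hx
    rw [← ncEval_skeinGenerator i j hij τ]
    exact ncEval_skeinGenerator_mem i j hij τ
  | zero => rw [map_zero]; exact zero_mem _
  | add x y _ _ hx hy => rw [map_add]; exact add_mem hx hy
  | smul a x _ hx => rw [map_zsmul]; exact Submodule.smul_mem _ _ hx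

/-! ### Block minima and sorting into a noncrossing partition -/

/-- The least element of the block of `x`. -/
def blockMin {n : ℕ} (π : Part n) (x : Fin n) : Fin n := (π.part x).min' ⟨x, self_mem π x⟩

theorem blockMin_mem {n : ℕ} (π : Part n) (x : Fin n) : blockMin π x ∈ π.part x := min'_mem _ _

theorem blockMin_eq_iff {n : ℕ} {π : Part n} {x y : Fin n} :
    blockMin π x = blockMin π y ↔ π.part x = π.part y := by
  constructor
  · intro h
    exact π.eq_of_mem_parts (part_mem' π x) (part_mem' π y) (blockMin_mem π x)
      (h ▸ blockMin_mem π y)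
  · intro h
    unfold blockMin
    congr

theorem part_eq_of_mem' {n : ℕ} {π : Part n} {P : Finset (Fin n)} (hP : P ∈ π.parts) {x : Fin n}
    (hx : x ∈ P) : π.part x = P := π.part_eq_of_mem hP hx

theorem blockMin_eq_of_mem {n : ℕ} {π : Part n} {P : Finset (Fin n)} (hP : P ∈ π.parts)
    {x y : Fin n} (hx : x ∈ P) (hy : y ∈ P) : blockMin π x = blockMin π y := by
  rw [blockMin_eq_iff, part_eq_of_mem' hP hx, part_eq_of_mem' hP hy]

theorem mem_iff_blockMin_eq {n : ℕ} {π : Part n} {P : Finset (Fin n)} (hP : P ∈ π.parts)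
    {x y : Fin n} (hx : x ∈ P) : y ∈ P ↔ blockMin π y = blockMin π x := by
  refine ⟨fun hy => blockMin_eq_of_mem hP hy hx, fun h => ?_⟩
  rw [blockMin_eq_iff, part_eq_of_mem' hP hx] at h
  exact h ▸ self_mem π y

/-- Sorting the elements by the minimum of their block turns every block into an interval, and
intervals do not cross. -/
theorem exists_permPart_noncrossing {n : ℕ} (π : Part n) :
    ∃ w : Equiv.Perm (Fin n), IsNoncrossing (permPart w π) := by
  -- The sorting permutation sends positions to elements; relabelling needs its inverse.
  refine ⟨(Tuple.sort (blockMin π))⁻¹, ?_⟩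
  have hmono := Tuple.monotone_sort (blockMin π)
  set σ := Tuple.sort (blockMin π)
  intro P hP Q hQ hne hcr
  rw [permPart_parts, mem_image] at hP hQ
  obtain ⟨A, hA, rfl⟩ := hP
  obtain ⟨B, hB, rfl⟩ := hQ
  obtain ⟨a, ha, b, hb, c, hc, d, hd, hab, hbc, hcd⟩ := hcr
  rw [mem_map_equiv] at ha hb hc
  have h1 : blockMin π (σ a) ≤ blockMin π (σ b) := hmono hab.le
  have h2 : blockMin π (σ b) ≤ blockMin π (σ c) := hmono hbc.le
  have h3 : blockMin π (σ a) = blockMin π (σ c) := blockMin_eq_of_mem hA ha hc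
  have hbA : σ b ∈ A := (mem_iff_blockMin_eq hA ha).2 (le_antisymm (h3 ▸ h2) h1)
  exact hne (by rw [π.eq_of_mem_parts hA hB hbA hb])

theorem fermionF_permPart_mem {n : ℕ} (w : Equiv.Perm (Fin n)) (π : Part n)
    (hπ : fermionF π ∈ ncLattice n) : fermionF (permPart w π) ∈ ncLattice n := by
  let S : Submonoid (Equiv.Perm (Fin n)) :=
    { carrier := {w | ∀ π : Part n, fermionF π ∈ ncLattice n →
        fermionF (permPart w π) ∈ ncLattice n}
      one_mem' := fun π h => by rwa [permPart_one]
      mul_mem' := fun hv hw π h => by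
        rw [permPart_mul]
        exact hv _ (hw _ h) }
  have hS : S = ⊤ := submonoid_eq_top_of_adjacent S fun i j hij π hπ => by
    have hne : i ≠ j := by rintro rfl; omega
    have h := permFermion_swap_mem_ncLattice i j hij hπ
    rw [permFermion_fermionF, Equiv.Perm.sign_swap hne] at h
    simpa using h
  have hw : w ∈ S := hS ▸ Submonoid.mem_top w
  exact hw π hπ

/-- Every `F_π` is an integral combination of the fermions of noncrossing partitions. -/
theorem fermionF_mem_ncLattice_of_part {n : ℕ} (π : Part n) : fermionF π ∈ ncLattice n := by
  obtain ⟨w, hw⟩ := exists_permPart_noncrossing π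
  have h := fermionF_permPart_mem w⁻¹ _ (fermionF_mem_ncLattice ⟨_, hw⟩)
  rwa [← permPart_mul, inv_mul_cancel, permPart_one] at h

theorem exists_int_coefficients {n : ℕ} (π : Part n) :
    ∃ c : NC n →₀ ℂ, ncEval n c = fermionF π ∧ ∀ μ, ∃ m : ℤ, c μ = m := by
  obtain ⟨c, hc⟩ := (Finsupp.mem_span_range_iff_exists_finsupp).1
    (fermionF_mem_ncLattice_of_part π)
  refine ⟨c.mapRange (fun m : ℤ => (m : ℂ)) (by simp), ?_, fun μ => ⟨c μ, by simp⟩⟩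
  rw [← hc, ncEval, Finsupp.linearCombination_apply, Finsupp.sum_mapRange_index (by simp)]
  exact Finsupp.sum_congr fun μ _ => Int.cast_smul_eq_zsmul ℂ _ _

/-! ### Noncrossing partitions are determined by the extreme elements of their blocks -/

/-- The greatest element of the block of `x`. -/
def blockMax {n : ℕ} (π : Part n) (x : Fin n) : Fin n := (π.part x).max' ⟨x, self_mem π x⟩

theorem blockMax_mem {n : ℕ} (π : Part n) (x : Fin n) : blockMax π x ∈ π.part x := max'_mem _ _

theorem blockMin_le {n : ℕ} {π : Part n} {x y : Fin n} (h : y ∈ π.part x) : blockMin π x ≤ y :=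
  min'_le _ _ h

theorem le_blockMax {n : ℕ} {π : Part n} {x y : Fin n} (h : y ∈ π.part x) : y ≤ blockMax π x :=
  le_max' _ _ h

theorem part_eq_of_mem_part {n : ℕ} {π : Part n} {x y : Fin n} (h : y ∈ π.part x) :
    π.part y = π.part x := part_eq_of_mem' (part_mem' π x) h

theorem blockMax_congr {n : ℕ} {π : Part n} {x y : Fin n} (h : π.part x = π.part y) :
    blockMax π x = blockMax π y := by
  unfold blockMax
  congr

theorem part_ext_of_blockMin {n : ℕ} {π π' : Part n} (h : ∀ x, blockMin π x = blockMin π' x) :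
    π = π' := by
  have key : ∀ {π π' : Part n}, (∀ x, blockMin π x = blockMin π' x) → π.parts ⊆ π'.parts := by
    intro π π' h P hP
    obtain ⟨x, hx⟩ := π.nonempty_of_mem_parts hP
    have : P = π'.part x := by
      ext y
      rw [mem_iff_blockMin_eq hP hx, mem_iff_blockMin_eq (part_mem' π' x) (self_mem π' x), h, h]
    exact this ▸ part_mem' π' x
  exact Finpartition.ext (Subset.antisymm (key h) (key fun x => (h x).symm))

/-- Strong induction on x shows that the block minima agree. If the π-block of x started before its
π'-minimum c, then c < x would also open a block of π, not containing x. That block cannot extend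
past x without crossing the block of x. If it ends at m < x, then m is a maximum for π' as well and,
by induction, lies in the π'-block of x, which would then end before x. -/
theorem noncrossing_ext {n : ℕ} {π π' : Part n} (hπ : IsNoncrossing π) (hπ' : IsNoncrossing π')
    (hmin : ∀ x, blockMin π x = x ↔ blockMin π' x = x)
    (hmax : ∀ x, blockMax π x = x ↔ blockMax π' x = x) : π = π' := by
  have key : ∀ {π π' : Part n}, IsNoncrossing π →
      (∀ x, blockMin π x = x ↔ blockMin π' x = x) →
      (∀ x, blockMax π x = x ↔ blockMax π' x = x) → ∀ x : Fin n,
      (∀ y < x, blockMin π y = blockMin π' y) → ¬ blockMin π x < blockMin π' x := by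
    intro π π' hπ hmin hmax x ih hlt
    have hle : blockMin π' x ≤ x := blockMin_le (self_mem π' x)
    have hne : blockMin π' x ≠ x := fun h => by
      rw [(hmin x).2 h, h] at hlt
      exact lt_irrefl _ hlt
    have hfix : blockMin π (blockMin π' x) = blockMin π' x := by
      rw [hmin, blockMin_eq_iff]
      exact part_eq_of_mem_part (blockMin_mem π' x)
    set c := blockMin π' x
    have hcx : c < x := lt_of_le_of_ne hle hne
    have hparts : π.part x ≠ π.part c := fun h => by
      rw [blockMin_eq_iff.2 h, hfix] at hlt
      exact lt_irrefl _ hlt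
    have hy := blockMax_mem π c
    rcases lt_trichotomy x (blockMax π c) with h | h | h
    · exact hπ _ (part_mem' π x) _ (part_mem' π c) hparts
        ⟨_, blockMin_mem π x, c, self_mem π c, x, self_mem π x, _, hy, hlt, hcx, h⟩
    · exact hparts (part_eq_of_mem_part (h ▸ hy))
    · have hpy := part_eq_of_mem_part hy
      have h1 : blockMax π' (blockMax π c) = blockMax π c := by
        rw [← hmax]
        exact blockMax_congr hpy
      have h2 : blockMin π' (blockMax π c) = blockMin π' x := by
        rw [← ih _ h, blockMin_eq_iff.2 hpy, hfix]
      have h3 : x ≤ blockMax π' x := le_blockMax (self_mem π' x)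
      rw [← blockMax_congr (blockMin_eq_iff.1 h2), h1] at h3
      exact absurd h (not_lt.2 h3)
  refine part_ext_of_blockMin fun x => ?_
  induction x using WellFoundedLT.induction with
  | ind x ih =>
    rcases lt_trichotomy (blockMin π x) (blockMin π' x) with h | h | h
    · exact absurd h (key hπ hmin hmax x ih)
    · exact h
    · exact absurd h (key hπ' (fun x => (hmin x).symm) (fun x => (hmax x).symm) x
        fun y hy => (ih y hy).symm)

/-! ### Minima, maxima and the spread of a partition -/

/-- The set of least elements of the blocks of `π`. -/
def minima {n : ℕ} (π : Part n) : Finset (Fin n) := univ.filter fun x => blockMin π x = x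

/-- The set of greatest elements of the blocks of `π`. -/
def maxima {n : ℕ} (π : Part n) : Finset (Fin n) := univ.filter fun x => blockMax π x = x

theorem mem_minima {n : ℕ} {π : Part n} {x : Fin n} : x ∈ minima π ↔ blockMin π x = x := by
  simp [minima]

theorem mem_maxima {n : ℕ} {π : Part n} {x : Fin n} : x ∈ maxima π ↔ blockMax π x = x := by
  simp [maxima]

theorem part_injOn_minima {n : ℕ} (π : Part n) : Set.InjOn π.part (minima π) := by
  intro a ha b hb h
  rw [mem_coe, mem_minima] at ha hb
  rw [← ha, ← hb, blockMin_eq_iff]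
  exact h

/-- An element chosen in a block determines the block, hence its minimum. -/
theorem injOn_minima_of_mem_part {n : ℕ} {π : Part n} {g : Fin n → Fin n}
    (hg : ∀ a ∈ minima π, g a ∈ π.part a) : Set.InjOn g (minima π) := by
  intro a ha b hb h
  refine part_injOn_minima π ha hb ?_
  rw [← part_eq_of_mem_part (hg a ha), ← part_eq_of_mem_part (hg b hb), h]

theorem image_part_minima {n : ℕ} (π : Part n) : (minima π).image π.part = π.parts := by
  ext P
  rw [mem_image]
  constructor
  · rintro ⟨a, -, rfl⟩
    exact part_mem' π a
  · intro hP
    obtain ⟨x, hx⟩ := π.nonempty_of_mem_parts hP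
    have h := part_eq_of_mem_part (blockMin_mem π x)
    exact ⟨blockMin π x, mem_minima.2 (blockMin_eq_iff.2 h), h.trans (part_eq_of_mem' hP hx)⟩

theorem image_blockMax_minima {n : ℕ} (π : Part n) :
    (minima π).image (blockMax π) = maxima π := by
  ext x
  rw [mem_image, mem_maxima]
  constructor
  · rintro ⟨a, -, rfl⟩
    exact blockMax_congr (part_eq_of_mem_part (blockMax_mem π a))
  · intro hx
    have h := part_eq_of_mem_part (blockMin_mem π x)
    exact ⟨blockMin π x, mem_minima.2 (blockMin_eq_iff.2 h), (blockMax_congr h).trans hx⟩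

theorem blockMax_injOn_minima {n : ℕ} (π : Part n) : Set.InjOn (blockMax π) (minima π) :=
  injOn_minima_of_mem_part fun a _ => blockMax_mem π a

theorem card_maxima {n : ℕ} (π : Part n) : (maxima π).card = (minima π).card := by
  rw [← image_blockMax_minima, card_image_of_injOn (blockMax_injOn_minima π)]

/-- The sum over the blocks of the least element minus the greatest element. -/
def negSpread {n : ℕ} (π : Part n) : ℤ := ∑ a ∈ minima π, (((a : ℕ) : ℤ) - ((blockMax π a : ℕ) : ℤ))

/-- If an element is chosen twice in each block of `π`, so that the first choices are minima for
`μ` and the second choices exhaust the maxima for `μ`, then the spread of `μ` is at most that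
of `π`, with equality only for the extreme choices. -/
theorem choice_eq_extreme {n : ℕ} {π μ : Part n} {f : Fin n → Fin n × Fin n}
    (h1 : ∀ a ∈ minima π, (f a).1 ∈ π.part a) (h2 : ∀ a ∈ minima π, (f a).2 ∈ π.part a)
    (hI : ∀ a ∈ minima π, (f a).1 ∈ minima μ)
    (hJ : ∀ b ∈ maxima μ, ∃ a ∈ minima π, (f a).2 = b) (hd : negSpread μ ≤ negSpread π) :
    (∀ a ∈ minima π, f a = (a, blockMax π a)) ∧ minima π = minima μ ∧ maxima π = maxima μ := by
  have i1 := injOn_minima_of_mem_part h1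
  have i2 := injOn_minima_of_mem_part h2
  have sI : (minima π).image (fun a => (f a).1) ⊆ minima μ := by
    intro x hx
    obtain ⟨a, ha, rfl⟩ := mem_image.1 hx
    exact hI a ha
  have sJ : maxima μ ⊆ (minima π).image (fun a => (f a).2) := by
    intro b hb
    obtain ⟨a, ha, rfl⟩ := hJ b hb
    exact mem_image.2 ⟨a, ha, rfl⟩
  have cI := card_image_of_injOn i1
  have cJ := card_image_of_injOn i2
  have lI := card_le_card sI
  have lJ := card_le_card sJ
  have cμ := card_maxima μ
  -- Both sets of choices have as many elements as π has blocks. One lies in the minima of μ and the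
  -- other contains its maxima, which are equinumerous, so both inclusions are equalities.
  have eI := eq_of_subset_of_card_le sI (by omega)
  have eJ := eq_of_subset_of_card_le sJ (by omega)
  have hμ : negSpread μ = ∑ a ∈ minima π, ((((f a).1 : ℕ) : ℤ) - (((f a).2 : ℕ) : ℤ)) := by
    unfold negSpread
    rw [sum_sub_distrib, sum_sub_distrib]
    congr 1
    · rw [← eI, sum_image i1]
    · rw [← sum_image (f := fun x : Fin n => ((x : ℕ) : ℤ)) i2, ← eJ, ← image_blockMax_minima,
        sum_image (blockMax_injOn_minima μ)]
  -- Within each block no choice has a smaller difference than the extreme one, so comparing the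
  -- total sums forces equality term by term.
  have hle : ∀ a ∈ minima π, (((a : ℕ) : ℤ) - ((blockMax π a : ℕ) : ℤ)) ≤
      ((((f a).1 : ℕ) : ℤ) - (((f a).2 : ℕ) : ℤ)) := by
    intro a ha
    have u : a ≤ (f a).1 := (mem_minima.1 ha).ge.trans (blockMin_le (h1 a ha))
    have v : (f a).2 ≤ blockMax π a := le_blockMax (h2 a ha)
    have u' : (a : ℕ) ≤ (f a).1 := u
    have v' : ((f a).2 : ℕ) ≤ blockMax π a := v
    omega
  rw [hμ] at hd
  have heq := (sum_eq_sum_iff_of_le hle).1 (le_antisymm (sum_le_sum hle) hd)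
  have hf : ∀ a ∈ minima π, f a = (a, blockMax π a) := by
    intro a ha
    have u : a ≤ (f a).1 := (mem_minima.1 ha).ge.trans (blockMin_le (h1 a ha))
    have v : (f a).2 ≤ blockMax π a := le_blockMax (h2 a ha)
    have u' : (a : ℕ) ≤ (f a).1 := u
    have v' : ((f a).2 : ℕ) ≤ blockMax π a := v
    have w := heq a ha
    refine Prod.ext (Fin.ext ?_) (Fin.ext ?_)
    · change ((f a).1 : ℕ) = a
      omega
    · change ((f a).2 : ℕ) = blockMax π a
      omega
  refine ⟨hf, ?_, ?_⟩
  · rw [← eI]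
    conv_lhs => rw [← image_id (s := minima π)]
    exact image_congr fun a ha => by simp [hf a ha]
  · rw [eJ, ← image_blockMax_minima]
    exact image_congr fun a ha => by simp [hf a ha]

/-! ### Monomials of the exterior algebra -/

section Monomials

variable {σ : Type*} [DecidableEq σ]

/-- The product of the generators in the list `L`. -/
noncomputable def monomial (L : List σ) : ExteriorAlgebra ℂ (σ → ℂ) :=
  (L.map fun s => ExteriorAlgebra.ι ℂ (Pi.single s (1 : ℂ))).prod

theorem monomial_cons (s : σ) (L : List σ) :
    monomial (s :: L) = ExteriorAlgebra.ι ℂ (Pi.single s (1 : ℂ)) * monomial L := by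
  simp [monomial]

theorem contractLeft_ι_single_mul (s t : σ) (f : ExteriorAlgebra ℂ (σ → ℂ)) :
    CliffordAlgebra.contractLeft (Q := (0 : QuadraticForm ℂ (σ → ℂ))) (LinearMap.proj s)
      (ExteriorAlgebra.ι ℂ (Pi.single t (1 : ℂ)) * f) =
    (if t = s then f else 0) - ExteriorAlgebra.ι ℂ (Pi.single t (1 : ℂ)) *
      CliffordAlgebra.contractLeft (Q := (0 : QuadraticForm ℂ (σ → ℂ))) (LinearMap.proj s) f := by
  have h := CliffordAlgebra.contractLeft_ι_mul (Q := (0 : QuadraticForm ℂ (σ → ℂ)))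
    (d := LinearMap.proj s) (Pi.single t (1 : ℂ)) f
  have h0 : (LinearMap.proj s : Module.Dual ℂ (σ → ℂ)) (Pi.single t (1 : ℂ)) =
      if t = s then 1 else 0 := by
    simp [Pi.single_apply, eq_comm]
  rw [h0, ite_smul, one_smul, zero_smul] at h
  exact h

theorem contractLeft_monomial_eq_zero {s : σ} {L : List σ} (hs : s ∉ L) :
    CliffordAlgebra.contractLeft (Q := (0 : QuadraticForm ℂ (σ → ℂ))) (LinearMap.proj s)
      (monomial L) = 0 := by
  induction L with
  | nil => exact CliffordAlgebra.contractLeft_one _ _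
  | cons t L ih =>
    rw [List.mem_cons, not_or] at hs
    rw [monomial_cons, contractLeft_ι_single_mul, if_neg (Ne.symm hs.1), ih hs.2, mul_zero,
      sub_zero]

/-- Contraction by the first generator strips it off, so vanishing would pass down to the empty
product 1. -/
theorem monomial_ne_zero {L : List σ} (hL : L.Nodup) : monomial L ≠ 0 := by
  induction L with
  | nil => simp [monomial]
  | cons s L ih =>
    rw [List.nodup_cons] at hL
    intro h
    have h2 := contractLeft_ι_single_mul s s (monomial L)
    rw [← monomial_cons, h, map_zero, contractLeft_monomial_eq_zero hL.1, if_pos rfl, mul_zero,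
      sub_zero] at h2
    exact ih hL.2 h2.symm

/-- The algebra endomorphism of the exterior algebra sending the generators outside `U` to `0`. -/
noncomputable def restrictGens (U : Finset σ) :
    ExteriorAlgebra ℂ (σ → ℂ) →ₐ[ℂ] ExteriorAlgebra ℂ (σ → ℂ) :=
  ExteriorAlgebra.map (LinearMap.pi fun s => if s ∈ U then LinearMap.proj s else 0)

theorem restrictGens_ι (U : Finset σ) (s : σ) :
    restrictGens U (ExteriorAlgebra.ι ℂ (Pi.single s (1 : ℂ))) =
      if s ∈ U then ExteriorAlgebra.ι ℂ (Pi.single s (1 : ℂ)) else 0 := by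
  unfold restrictGens
  rw [ExteriorAlgebra.map_apply_ι]
  split_ifs with h
  · congr 1
    ext t
    by_cases ht : t = s
    · subst ht; simp [h]
    · by_cases htU : t ∈ U <;> simp [htU, ht]
  · rw [← map_zero (ExteriorAlgebra.ι ℂ)]
    congr 1
    ext t
    by_cases ht : t = s
    · subst ht; simp [h]
    · by_cases htU : t ∈ U <;> simp [htU, ht]

/-- With the next lemma, `restrictGens` isolates the monomials supported in U, so no basis of the
exterior algebra is needed. -/
theorem restrictGens_monomial_of_subset {U : Finset σ} {L : List σ} (h : ∀ s ∈ L, s ∈ U) :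
    restrictGens U (monomial L) = monomial L := by
  unfold monomial
  rw [map_list_prod, List.map_map]
  congr 1
  exact List.map_congr_left fun s hs => (restrictGens_ι U s).trans (if_pos (h s hs))

theorem restrictGens_monomial_of_notMem {U : Finset σ} {L : List σ} {s : σ} (hs : s ∈ L)
    (hU : s ∉ U) : restrictGens U (monomial L) = 0 := by
  unfold monomial
  rw [map_list_prod, List.map_map]
  exact List.prod_eq_zero (List.mem_map.2 ⟨s, hs, (restrictGens_ι U s).trans (if_neg hU)⟩)

end Monomials

/-! ### Polarization operators on monomials -/

theorem contractTheta_monomial_xi_mul {n : ℕ} (j : Fin n) (K : List (Fin n)) (f : Fermion n) :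
    contractTheta j (monomial (K.map Sum.inr) * f) =
      (-1 : ℂ) ^ K.length • (monomial (K.map Sum.inr) * contractTheta j f) := by
  induction K with
  | nil => simp [monomial]
  | cons i K ih =>
    rw [List.map_cons, monomial_cons, mul_assoc]
    refine (contractTheta_xi_mul j i _).trans ?_
    rw [ih, List.length_cons, pow_succ]
    simp only [mul_smul_comm, mul_assoc, mul_neg, mul_one, neg_smul]
    rfl

/-- The scalar is a sign, but only its being nonzero matters for linear independence. -/
theorem contractTheta_monomial_theta {n : ℕ} {j : Fin n} {l : List (Fin n)} (hl : l.Nodup)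
    (hj : j ∈ l) : ∃ z : ℂ, z ≠ 0 ∧
      contractTheta j (monomial (l.map Sum.inl)) = z • monomial ((l.erase j).map Sum.inl) := by
  induction l with
  | nil => simp at hj
  | cons i l ih =>
    rw [List.nodup_cons] at hl
    rw [List.map_cons, monomial_cons]
    have h := contractTheta_theta_mul j i (monomial (l.map Sum.inl))
    by_cases hij : i = j
    · subst hij
      refine ⟨1, one_ne_zero, h.trans ?_⟩
      have h0 : contractTheta i (monomial (l.map Sum.inl)) = 0 :=
        contractLeft_monomial_eq_zero (by simpa using hl.1)
      rw [h0]
      simp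
    · obtain ⟨z, hz, hzl⟩ := ih hl.2 ((List.mem_cons.1 hj).resolve_left (Ne.symm hij))
      refine ⟨-z, neg_ne_zero.2 hz, h.trans ?_⟩
      rw [hzl, if_neg hij, List.erase_cons_tail (by simpa using hij), List.map_cons, monomial_cons,
        zero_sub, mul_smul_comm, neg_smul]
      rfl

/-- A product of polarization operators with distinct contracted indices sends `θ_1 ⋯ θ_n` to a
nonzero multiple of a monomial. -/
theorem polarization_list_thetaProd {n : ℕ} (c : List (Fin n × Fin n))
    (hc : (c.map Prod.snd).Nodup) : ∃ z : ℂ, z ≠ 0 ∧ ∃ l : List (Fin n), l.Nodup ∧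
      (∀ x, x ∈ l ↔ x ∉ c.map Prod.snd) ∧
      (c.map fun p => polarization p.1 p.2).prod (List.ofFn fun i : Fin n => theta i).prod =
        z • (monomial ((c.map Prod.fst).map Sum.inr) * monomial (l.map Sum.inl)) := by
  induction c with
  | nil =>
    refine ⟨1, one_ne_zero, List.finRange n, List.nodup_finRange n, by simp, ?_⟩
    simp only [monomial, List.ofFn_eq_map, List.map_map, List.map_nil, List.prod_nil, one_smul,
      one_mul]
    rfl
  | cons p c ih =>
    rw [List.map_cons, List.nodup_cons] at hc
    obtain ⟨z, hz, l, hl, hmem, heq⟩ := ih hc.2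
    obtain ⟨y, hy, hyl⟩ := contractTheta_monomial_theta hl ((hmem p.2).2 hc.1)
    refine ⟨z * (-1) ^ (c.map Prod.fst).length * y,
      mul_ne_zero (mul_ne_zero hz (pow_ne_zero _ (by norm_num))) hy, l.erase p.2, hl.erase _, ?_, ?_⟩
    · intro x
      rw [hl.mem_erase_iff, hmem, List.map_cons, List.mem_cons, not_or]
    · rw [List.map_cons, List.prod_cons, Module.End.mul_apply, heq, map_smul]
      change z • (xi p.1 * contractTheta p.2 _) = _
      rw [contractTheta_monomial_xi_mul, hyl, List.map_cons, List.map_cons, monomial_cons]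
      simp only [mul_smul_comm, smul_smul, mul_assoc]
      rfl

/-! ### Linear independence -/

/-- Expansion of a product of sums to which only one choice of summands contributes. -/
theorem map_prod_sum_eq_single {α β A M : Type*} [DecidableEq α] [Ring A] [AddCommGroup M]
    (t : α → Finset β) (g : α → β → A) (f₀ : α → β) (L : List α) (hL : L.Nodup)
    (h₀ : ∀ a ∈ L, f₀ a ∈ t a) (φ : A →+ M)
    (h : ∀ f : α → β, (∀ a ∈ L, f a ∈ t a) → φ (L.map fun a => g a (f a)).prod ≠ 0 →
      ∀ a ∈ L, f a = f₀ a) :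
    φ (L.map fun a => ∑ b ∈ t a, g a b).prod = φ (L.map fun a => g a (f₀ a)).prod := by
  induction L generalizing φ with
  | nil => rfl
  | cons a L ih =>
    rw [List.nodup_cons] at hL
    -- Updating f at a glues a choice at the head to a choice on the tail; a does not recur in L.
    have hup : ∀ (f : α → β) (b : β), ∀ x ∈ L, Function.update f a b x = f x := fun f b x hx =>
      Function.update_of_ne (fun hxa : x = a => hL.1 (hxa ▸ hx)) _ _
    have hmap : ∀ (f : α → β) (b : β), ((a :: L).map fun x => g x (Function.update f a b x)).prod =
        g a b * (L.map fun x => g x (f x)).prod := by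
      intro f b
      rw [List.map_cons, List.prod_cons, Function.update_self]
      congr 2
      exact List.map_congr_left fun x hx => by rw [hup f b x hx]
    have key : ∀ b ∈ t a, ∀ f : α → β, (∀ x ∈ L, f x ∈ t x) →
        φ (g a b * (L.map fun x => g x (f x)).prod) ≠ 0 → b = f₀ a ∧ ∀ x ∈ L, f x = f₀ x := by
      intro b hb f hf hne
      rw [← hmap] at hne
      have := h (Function.update f a b) (fun x hx => by
        rcases List.mem_cons.1 hx with rfl | hx
        · rwa [Function.update_self]
        · rw [hup f b x hx]
          exact hf x hx) hne
      refine ⟨?_, fun x hx => ?_⟩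
      · simpa using this a List.mem_cons_self
      · rw [← this x (List.mem_cons_of_mem _ hx), hup f b x hx]
    have h₀' : ∀ x ∈ L, f₀ x ∈ t x := fun x hx => h₀ x (List.mem_cons_of_mem _ hx)
    -- The head factor is absorbed into the additive map, which is why the induction generalizes φ.
    have ih' : ∀ b ∈ t a, φ (g a b * (L.map fun x => ∑ c ∈ t x, g x c).prod) =
        φ (g a b * (L.map fun x => g x (f₀ x)).prod) := fun b hb =>
      ih hL.2 h₀' (φ.comp (AddMonoidHom.mulLeft (g a b))) fun f hf hne => (key b hb f hf hne).2
    simp only [List.map_cons, List.prod_cons]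
    rw [sum_mul, _root_.map_sum, sum_congr rfl ih']
    refine sum_eq_single_of_mem _ (h₀ a List.mem_cons_self) fun b hb hne => ?_
    by_contra hcon
    exact hne (key b hb f₀ h₀' hcon).1

/-- The pairs of indices occurring in the block operator of `B`. -/
def blockPairs {n : ℕ} (B : Finset (Fin n)) : Finset (Fin n × Fin n) :=
  if 1 < B.card then B.offDiag else B.diag

theorem blockOp_eq_sum_blockPairs {n : ℕ} (B : Finset (Fin n)) :
    blockOp B = ∑ p ∈ blockPairs B, polarization p.1 p.2 := by
  unfold blockOp blockPairs
  split_ifs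
  · rw [sum_sigma']
    refine sum_bij (fun x _ => (x.1, x.2)) ?_ ?_ ?_ ?_
    · rintro ⟨i, j⟩ h
      simp only [mem_sigma, mem_erase] at h
      exact mem_offDiag.2 ⟨h.1, h.2.2, h.2.1.symm⟩
    · rintro ⟨i, j⟩ _ ⟨k, l⟩ _ h
      simpa using h
    · rintro ⟨i, j⟩ h
      rw [mem_offDiag] at h
      exact ⟨⟨i, j⟩, by simpa using ⟨h.1, h.2.2.symm, h.2.1⟩, rfl⟩
    · intros
      rfl
  · rw [sum_diag]

theorem mem_of_mem_blockPairs {n : ℕ} {B : Finset (Fin n)} {p : Fin n × Fin n}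
    (h : p ∈ blockPairs B) : p.1 ∈ B ∧ p.2 ∈ B := by
  unfold blockPairs at h
  split_ifs at h
  · rw [mem_offDiag] at h
    exact ⟨h.1, h.2.1⟩
  · rw [mem_diag] at h
    exact ⟨h.1, h.2 ▸ h.1⟩

/-- In a block with at least two elements the minimum and maximum differ; a singleton is covered by
its diagonal pair. -/
theorem extreme_mem_blockPairs {n : ℕ} {π : Part n} {a : Fin n} (ha : a ∈ minima π) :
    (a, blockMax π a) ∈ blockPairs (π.part a) := by
  have hmin := mem_minima.1 ha
  unfold blockPairs
  split_ifs with h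
  · refine mem_offDiag.2 ⟨self_mem π a, blockMax_mem π a, fun hmax => ?_⟩
    change a = blockMax π a at hmax
    obtain ⟨x, hx, hxa⟩ := exists_mem_ne h a
    have h1 := blockMin_le hx
    have h2 := le_blockMax hx
    rw [hmin] at h1
    rw [← hmax] at h2
    exact hxa (le_antisymm h2 h1)
  · exact mem_diag.2 ⟨self_mem π a, card_le_one.1 (not_lt.1 h) _ (self_mem π a) _
      (blockMax_mem π a)⟩

/-- The generators `ξ_a` with `a` a minimum and `θ_b` with `b` not a maximum of a block of `μ`. -/
def extremeGens {n : ℕ} (μ : Part n) : Finset (Fin n ⊕ Fin n) :=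
  ((maxima μ)ᶜ).disjSum (minima μ)

/-- A choice of pairs yields a nonzero multiple of a single monomial: ξ at the first entries, θ away
from the second entries. It survives exactly when all its generators are kept. -/
theorem restrictGens_choice {n : ℕ} {π : Part n} (μ : Part n) {f : Fin n → Fin n × Fin n}
    (h1 : ∀ a ∈ minima π, (f a).1 ∈ π.part a) (h2 : ∀ a ∈ minima π, (f a).2 ∈ π.part a) :
    restrictGens (extremeGens μ) (((minima π).toList.map fun a => polarization (f a).1 (f a).2).prod
      (List.ofFn fun i : Fin n => theta i).prod) ≠ 0 ↔
    (∀ a ∈ minima π, (f a).1 ∈ minima μ) ∧ ∀ b ∈ maxima μ, ∃ a ∈ minima π, (f a).2 = b := by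
  have i1 := injOn_minima_of_mem_part h1
  have i2 := injOn_minima_of_mem_part h2
  have n1 : (((minima π).toList.map f).map Prod.fst).Nodup := by
    rw [List.map_map]
    exact (nodup_toList _).map_on fun a ha b hb hab =>
      i1 (mem_coe.2 (mem_toList.1 ha)) (mem_coe.2 (mem_toList.1 hb)) hab
  have n2 : (((minima π).toList.map f).map Prod.snd).Nodup := by
    rw [List.map_map]
    exact (nodup_toList _).map_on fun a ha b hb hab =>
      i2 (mem_coe.2 (mem_toList.1 ha)) (mem_coe.2 (mem_toList.1 hb)) hab
  obtain ⟨z, hz, l, hl, hmem, heq⟩ := polarization_list_thetaProd ((minima π).toList.map f) n2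
  rw [List.map_map] at heq
  have heq' : ((minima π).toList.map fun a => polarization (f a).1 (f a).2).prod
      (List.ofFn fun i : Fin n => theta i).prod = _ := heq
  have hmono : (monomial ((((minima π).toList.map f).map Prod.fst).map Sum.inr) *
      monomial (l.map Sum.inl) : Fermion n) =
      monomial ((((minima π).toList.map f).map Prod.fst).map Sum.inr ++ l.map Sum.inl) := by
    simp [monomial]
  rw [heq', hmono, map_smul]
  constructor
  · intro hne
    by_contra hcon
    refine hne ?_
    rw [not_and_or] at hcon
    suffices h : ∃ s ∈ (((minima π).toList.map f).map Prod.fst).map Sum.inr ++ l.map Sum.inl,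
        s ∉ extremeGens μ by
      obtain ⟨s, hs, hU⟩ := h
      rw [restrictGens_monomial_of_notMem hs hU, smul_zero]
    rcases hcon with hcon | hcon
    · push Not at hcon
      obtain ⟨a, ha, hf⟩ := hcon
      refine ⟨Sum.inr (f a).1, ?_, ?_⟩
      · simp only [List.mem_append, List.mem_map, mem_toList]
        exact Or.inl ⟨_, ⟨_, ⟨a, ha, rfl⟩, rfl⟩, rfl⟩
      · simpa [extremeGens] using hf
    · push Not at hcon
      obtain ⟨b, hb, hf⟩ := hcon
      refine ⟨Sum.inl b, ?_, ?_⟩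
      · refine List.mem_append_right _ (List.mem_map.2 ⟨b, (hmem b).2 ?_, rfl⟩)
        simp only [List.mem_map, mem_toList]
        rintro ⟨_, ⟨a, ha, rfl⟩, hab⟩
        exact hf a ha hab
      · simpa [extremeGens] using hb
  · rintro ⟨hI, hJ⟩
    rw [restrictGens_monomial_of_subset]
    · refine smul_ne_zero hz (monomial_ne_zero ?_)
      refine List.Nodup.append (n1.map Sum.inr_injective) (hl.map Sum.inl_injective) ?_
      intro s hs hs'
      obtain ⟨x, -, rfl⟩ := List.mem_map.1 hs
      obtain ⟨y, -, hy⟩ := List.mem_map.1 hs'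
      exact Sum.inl_ne_inr hy
    · intro s hs
      rcases List.mem_append.1 hs with hs | hs
      · simp only [List.mem_map, mem_toList] at hs
        obtain ⟨_, ⟨_, ⟨a, ha, rfl⟩, rfl⟩, rfl⟩ := hs
        simpa [extremeGens] using hI a ha
      · obtain ⟨x, hx, rfl⟩ := List.mem_map.1 hs
        have hx' := (hmem x).1 hx
        have : x ∉ maxima μ := fun hxm => by
          obtain ⟨a, ha, hax⟩ := hJ x hxm
          refine hx' ?_
          simp only [List.mem_map, mem_toList]
          exact ⟨_, ⟨a, ha, rfl⟩, hax⟩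
        simpa [extremeGens] using this

theorem partOp_eq_prod_minima {n : ℕ} (π : Part n) :
    partOp π = ((minima π).toList.map fun a =>
      ∑ p ∈ blockPairs (π.part a), polarization p.1 p.2).prod := by
  rw [partOp_eq_list_prod π ((minima π).toList.map π.part), List.map_map]
  · congr 1
    exact List.map_congr_left fun a _ => blockOp_eq_sum_blockPairs _
  · exact (nodup_toList _).map_on fun a ha b hb hab =>
      part_injOn_minima π (mem_coe.2 (mem_toList.1 ha)) (mem_coe.2 (mem_toList.1 hb)) hab
  · rw [← image_part_minima]
    ext P
    simp

/-- By `choice_eq_extreme` only the extreme choice can survive in the expansion of F_π, so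
cancellation between choices cannot occur. -/
theorem restrictGens_fermionF {n : ℕ} (π μ : Part n) (hd : negSpread μ ≤ negSpread π) :
    restrictGens (extremeGens μ) (fermionF π) =
      restrictGens (extremeGens μ)
        (((minima π).toList.map fun a => polarization a (blockMax π a)).prod
          (List.ofFn fun i : Fin n => theta i).prod) := by
  unfold fermionF
  rw [partOp_eq_prod_minima]
  refine map_prod_sum_eq_single (fun a => blockPairs (π.part a))
    (fun _ p => polarization p.1 p.2) (fun a => (a, blockMax π a)) _ (nodup_toList _)
    (fun a ha => extreme_mem_blockPairs (mem_toList.1 ha))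
    (((restrictGens (extremeGens μ)).toLinearMap ∘ₗ
      LinearMap.applyₗ (List.ofFn fun i : Fin n => theta i).prod).toAddMonoidHom) ?_
  intro f hf hne a ha
  have h1 : ∀ a ∈ minima π, (f a).1 ∈ π.part a := fun a ha =>
    (mem_of_mem_blockPairs (hf a (mem_toList.2 ha))).1
  have h2 : ∀ a ∈ minima π, (f a).2 ∈ π.part a := fun a ha =>
    (mem_of_mem_blockPairs (hf a (mem_toList.2 ha))).2
  obtain ⟨hI, hJ⟩ := (restrictGens_choice μ h1 h2).1 hne
  exact (choice_eq_extreme h1 h2 hI hJ hd).1 a (mem_toList.1 ha)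

theorem restrictGens_fermionF_self {n : ℕ} (μ : Part n) :
    restrictGens (extremeGens μ) (fermionF μ) ≠ 0 := by
  rw [restrictGens_fermionF μ μ le_rfl]
  refine (restrictGens_choice μ (f := fun a => (a, blockMax μ a)) (fun a _ => self_mem μ a)
    fun a _ => blockMax_mem μ a).2 ⟨fun a ha => ha, fun b hb => ?_⟩
  rw [← image_blockMax_minima] at hb
  exact mem_image.1 hb

/-- Survival of the extreme term would force equal minima and maxima, hence π = μ by
`noncrossing_ext`. -/
theorem restrictGens_fermionF_of_ne {n : ℕ} {π μ : NC n} (hne : π ≠ μ)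
    (hd : negSpread μ.1 ≤ negSpread π.1) :
    restrictGens (extremeGens μ.1) (fermionF π.1) = 0 := by
  rw [restrictGens_fermionF π.1 μ.1 hd]
  by_contra hcon
  have h1 : ∀ a ∈ minima π.1, a ∈ π.1.part a := fun a _ => self_mem _ a
  have h2 : ∀ a ∈ minima π.1, blockMax π.1 a ∈ π.1.part a := fun a _ => blockMax_mem _ a
  obtain ⟨hI, hJ⟩ := (restrictGens_choice μ.1 (f := fun a => (a, blockMax π.1 a)) h1 h2).1 hcon
  obtain ⟨-, hmin, hmax⟩ :=
    choice_eq_extreme (f := fun a => (a, blockMax π.1 a)) h1 h2 hI hJ hd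
  refine hne (Subtype.ext (noncrossing_ext π.2 μ.2 (fun x => ?_) fun x => ?_))
  · rw [← mem_minima, ← mem_minima, hmin]
  · rw [← mem_maxima, ← mem_maxima, hmax]

/-- The fermions of the noncrossing partitions are linearly independent. -/
theorem ncEval_injective (n : ℕ) : Function.Injective (ncEval n) := by
  rw [injective_iff_map_eq_zero]
  intro x hx
  by_contra hne
  -- Restricting to the extreme generators of a partition of largest spread in the support kills
  -- every other term.
  obtain ⟨μ, hμ, hmin⟩ := exists_min_image x.support (fun μ => negSpread μ.1)
    (Finsupp.support_nonempty_iff.2 hne)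
  have h := congrArg (restrictGens (extremeGens μ.1)) hx
  rw [ncEval, Finsupp.linearCombination_apply, Finsupp.sum, _root_.map_sum, map_zero,
    sum_eq_single_of_mem μ hμ] at h
  · rw [map_smul] at h
    exact smul_ne_zero (Finsupp.mem_support_iff.1 hμ) (restrictGens_fermionF_self μ.1) h
  · intro π hπ hπμ
    rw [map_smul, restrictGens_fermionF_of_ne hπμ (hmin π hπ), smul_zero]

/-! ### The crossing resolution and the skein action -/

/-- As a factorization of `partEval` through `ncEval`, the condition lets injectivity settle
identities about p. -/
theorem isCrossingResolution_iff {n : ℕ} (p : (Part n →₀ ℂ) →ₗ[ℂ] (NC n →₀ ℂ)) :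
    IsCrossingResolution p ↔ ∀ x, ncEval n (p x) = partEval n x := by
  constructor
  · intro h x
    have : ncEval n ∘ₗ p = partEval n := by
      ext π
      simp only [LinearMap.comp_apply, Finsupp.lsingle_apply, partEval_single]
      rw [h π, ncEval, Finsupp.linearCombination_apply]
    exact LinearMap.congr_fun this x
  · intro h π
    have := h (Finsupp.single π 1)
    rw [partEval_single, ncEval, Finsupp.linearCombination_apply] at this
    exact this.symm

theorem exists_crossingResolution (n : ℕ) :
    ∃ p : (Part n →₀ ℂ) →ₗ[ℂ] (NC n →₀ ℂ), IsCrossingResolution p := by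
  choose c hc _ using fun π : Part n => exists_int_coefficients π
  refine ⟨Finsupp.linearCombination ℂ c, fun π => ?_⟩
  rw [Finsupp.linearCombination_single, one_smul, ← hc π, ncEval, Finsupp.linearCombination_apply]

theorem IsCrossingResolution.eq {n : ℕ} {p q : (Part n →₀ ℂ) →ₗ[ℂ] (NC n →₀ ℂ)}
    (hp : IsCrossingResolution p) (hq : IsCrossingResolution q) : p = q := by
  rw [isCrossingResolution_iff] at hp hq
  exact LinearMap.ext fun x => ncEval_injective n ((hp x).trans (hq x).symm)

theorem IsCrossingResolution.apply_noncrossing {n : ℕ} {p : (Part n →₀ ℂ) →ₗ[ℂ] (NC n →₀ ℂ)}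
    (hp : IsCrossingResolution p) (μ : NC n) :
    p (Finsupp.single μ.1 1) = Finsupp.single μ 1 := by
  rw [isCrossingResolution_iff] at hp
  exact ncEval_injective n (by rw [hp, partEval_single, ncEval_single])

theorem IsCrossingResolution.surjective {n : ℕ} {p : (Part n →₀ ℂ) →ₗ[ℂ] (NC n →₀ ℂ)}
    (hp : IsCrossingResolution p) : Function.Surjective p := by
  intro x
  refine ⟨x.mapDomain Subtype.val, ?_⟩
  have : p ∘ₗ Finsupp.lmapDomain ℂ ℂ (Subtype.val : NC n → Part n) = LinearMap.id := by
    ext1 μ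
    ext1
    simp [hp.apply_noncrossing]
  exact LinearMap.congr_fun this x

theorem IsCrossingResolution.exists_int {n : ℕ} {p : (Part n →₀ ℂ) →ₗ[ℂ] (NC n →₀ ℂ)}
    (hp : IsCrossingResolution p) (π : Part n) (μ : NC n) :
    ∃ m : ℤ, p (Finsupp.single π 1) μ = (m : ℂ) := by
  rw [isCrossingResolution_iff] at hp
  obtain ⟨c, hc, hint⟩ := exists_int_coefficients π
  have : p (Finsupp.single π 1) = c := ncEval_injective n (by rw [hp, partEval_single, hc])
  rw [this]
  exact hint μ

/-- The inclusion `ℂ[NC(n)] → ℂ[Π(n)]`. -/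
noncomputable def ncInclusion (n : ℕ) : (NC n →₀ ℂ) →ₗ[ℂ] (Part n →₀ ℂ) :=
  Finsupp.lmapDomain ℂ ℂ Subtype.val

theorem partEval_ncInclusion {n : ℕ} (x : NC n →₀ ℂ) :
    partEval n (ncInclusion n x) = ncEval n x := by
  have : partEval n ∘ₗ ncInclusion n = ncEval n := by
    ext μ
    simp [ncInclusion, partEval, ncEval]
  exact LinearMap.congr_fun this x

/-- The action on noncrossing partitions transported from the sign-twisted action. -/
theorem exists_representation (n : ℕ) :
    ∃ ρ : Representation ℂ (Equiv.Perm (Fin n)) (NC n →₀ ℂ),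
      ∀ w x, ncEval n (ρ w x) = permFermion w (ncEval n x) := by
  obtain ⟨p, hp⟩ := exists_crossingResolution n
  rw [isCrossingResolution_iff] at hp
  have key : ∀ w x, ncEval n (p (signTwistedAction n w (ncInclusion n x))) =
      permFermion w (ncEval n x) := fun w x => by
    rw [hp, ← permFermion_partEval, partEval_ncInclusion]
  refine ⟨{ toFun := fun w => p ∘ₗ signTwistedAction n w ∘ₗ ncInclusion n
            map_one' := ?_
            map_mul' := ?_ }, key⟩
  · refine LinearMap.ext fun x => ncEval_injective n ?_
    change ncEval n (p (signTwistedAction n 1 (ncInclusion n x))) = ncEval n x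
    rw [hp, map_one, Module.End.one_apply, partEval_ncInclusion]
  · refine fun v w => LinearMap.ext fun x => ncEval_injective n ?_
    change ncEval n (p (signTwistedAction n (v * w) (ncInclusion n x))) =
      ncEval n (p (signTwistedAction n v
        (ncInclusion n (p (signTwistedAction n w (ncInclusion n x))))))
    -- Multiplicativity is borrowed from the sign-twisted action on ℂ[Π(n)] and transported along
    -- `partEval`.
    rw [key v, key w, hp, map_mul, Module.End.mul_apply, ← permFermion_partEval,
      ← permFermion_partEval, partEval_ncInclusion]

theorem IsSkeinAction.eq {n : ℕ} {ρ ρ' : Representation ℂ (Equiv.Perm (Fin n)) (NC n →₀ ℂ)}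
    (h : IsSkeinAction ρ) (h' : IsSkeinAction ρ') : ρ = ρ' := by
  have hS : MonoidHom.eqLocusM ρ ρ' = ⊤ := submonoid_eq_top_of_adjacent _ fun i j hij => by
    change ρ (Equiv.swap i j) = ρ' (Equiv.swap i j)
    ext1 τ
    ext1
    exact (h i j hij τ).trans (h' i j hij τ).symm
  exact MonoidHom.ext fun w => (hS ▸ Submonoid.mem_top w : w ∈ MonoidHom.eqLocusM ρ ρ')

theorem isSkeinAction_of_ncEval {n : ℕ}
    {ρ : Representation ℂ (Equiv.Perm (Fin n)) (NC n →₀ ℂ)}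
    (h : ∀ w x, ncEval n (ρ w x) = permFermion w (ncEval n x)) : IsSkeinAction ρ := fun i j hij τ =>
  ncEval_injective n (by rw [h, ncEval_single, ncEval_skeinGenerator])

/-- By uniqueness any skein action is the transported one, so the rule on generators alone gives
compatibility with all permutations. -/
theorem IsSkeinAction.ncEval_apply {n : ℕ}
    {ρ : Representation ℂ (Equiv.Perm (Fin n)) (NC n →₀ ℂ)} (h : IsSkeinAction ρ)
    (w : Equiv.Perm (Fin n)) (x : NC n →₀ ℂ) :
    ncEval n (ρ w x) = permFermion w (ncEval n x) := by
  obtain ⟨ρ', hρ'⟩ := exists_representation n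
  rw [h.eq (isSkeinAction_of_ncEval hρ'), hρ']

end SkeinResolution

theorem theorem6p3 (n : ℕ) :
    -- the crossing resolution and the skein action are well defined
    (∃! p : (SkeinResolution.Part n →₀ ℂ) →ₗ[ℂ] (SkeinResolution.NC n →₀ ℂ),
      SkeinResolution.IsCrossingResolution p) ∧
    (∃! ρ : Representation ℂ (Equiv.Perm (Fin n)) (SkeinResolution.NC n →₀ ℂ),
      SkeinResolution.IsSkeinAction ρ) ∧
    ∀ (p : (SkeinResolution.Part n →₀ ℂ) →ₗ[ℂ] (SkeinResolution.NC n →₀ ℂ))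
      (ρ : Representation ℂ (Equiv.Perm (Fin n)) (SkeinResolution.NC n →₀ ℂ)),
      SkeinResolution.IsCrossingResolution p → SkeinResolution.IsSkeinAction ρ →
        -- equivariance
        (∀ (w : Equiv.Perm (Fin n)) (x : SkeinResolution.Part n →₀ ℂ),
          p (SkeinResolution.signTwistedAction n w x) = ρ w (p x)) ∧
        -- integer coefficients
        (∀ (π : SkeinResolution.Part n) (μ : SkeinResolution.NC n),
          ∃ m : ℤ, p (Finsupp.single π 1) μ = (m : ℂ)) ∧
        -- `p` fixes noncrossing partitions, and is onto
        (∀ μ : SkeinResolution.NC n, p (Finsupp.single μ.1 1) = Finsupp.single μ 1) ∧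
        Function.Surjective p := by
  refine ⟨?_, ?_, fun p ρ hp hρ => ⟨fun w x => ?_, hp.exists_int, hp.apply_noncrossing,
    hp.surjective⟩⟩
  · obtain ⟨p, hp⟩ := SkeinResolution.exists_crossingResolution n
    exact ⟨p, hp, fun q hq => hq.eq hp⟩
  · obtain ⟨ρ, hρ⟩ := SkeinResolution.exists_representation n
    have hs := SkeinResolution.isSkeinAction_of_ncEval hρ
    exact ⟨ρ, hs, fun ρ' hρ' => hρ'.eq hs⟩
  · rw [SkeinResolution.isCrossingResolution_iff] at hp
    -- Both sides evaluate to w applied to the fermion of x.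
    refine SkeinResolution.ncEval_injective n ?_
    rw [hp, hρ.ncEval_apply, hp, SkeinResolution.permFermion_partEval]
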